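/- **Conventions.** Fix $d$. Let $q$ run over the odd prime powers, put $\|x-y\|=\sum_{k=1}^d (x_k-y_k)^2$ for $x,y\in\mathbb F_q^d$, and let $O_d(\mathbb F_q)$ be the orthogonal group of the standard inner product. We write $X\lesssim Y$ if $X\le CY$ with a constant $C>0$ independent of $q$ and of the set $E\subset\mathbb F_q^d$; $X \gtrsim Y$ means $Y\lesssim X$, and $X\approx Y$ means $X\lesssim Y\lesssim X$. An $n$-simplex is a complete graph on $n+1$ vertices. Two maps $p,p'$ of its vertex set $\{0,\dots,n\}$ to $\mathbb F_q^d$ are congruent if $\|p(i)-p(j)\|=\|p'(i)-p'(j)\|$ for all $i,j$. Let $c_d(n)$ be the integer such that the number of congruence classes of $n$-simplices in $\mathbb F_q^d$ is $\approx q^{c_d(n)}$. Let $\mathrm{Stab}(n)$ be the minimum over $(y_0,\dots,y_n)\in(\mathbb F_q^d)^{n+1}$ of the number of $\theta\in O_d(\mathbb F_q)$ fixing every $y_i-y_0$. **Simplex trees.** A rooted simplex tree $(\mathcal T,S_0)$ is a finite family $\mathcal T$ of simplices, given by nonempty finite vertex sets, with a distinguished member $S_0$ (the root), such that distinct simplices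 share at most one vertex, any two simplices are joined by a path of simplices in which consecutive members share a vertex, and there is no closed loop, i.e. there are no distinct simplices $S^1,\dots,S^n$ and distinct vertices $v_1,\dots,v_n$, $n\ge3$, with $v_j\in S^j\cap S^{j+1}$ for all $j$ (indices mod $n$). The depth of a simplex is the length of a shortest path of simplices from $S_0$ to it. A vertex of $S$ is free if no other simplex of $\mathcal T$ contains it. Let $V(\mathcal T)$ be the set of all vertices, and $c(\mathcal T)=\sum_{S\in\mathcal T}c_d(\dim S)$. For $v\in S$ let $\mathcal B(S,v)$ be the set of the simplices of $\mathcal T$ containing $v$ and of greater depth than $S$ (the roots of the branches of $S$ at $v$). For $E\subset\mathbb F_q^d$, a simplex $S$ and $v_0\in S$ define recursively $$D_{S,v_0}(u,u')=\frac1{\mathrm{Stab}(\dim S)}\sum_{\theta\in O_d(\mathbb F_q)}\ \prod_{v\in S,\,v\ne v_0}\ \sum_{\substack{x,x'\in E\\ x-\theta x'=u-\theta u'}}\ \prod_{S'\in\mathcal B(S,v)}D_{S',v}(x,x'),$$ $$R_{(\mathcal T,S_0)}=\frac1{\mathrm{Stab}(\dim S_0)}\sum_{w\in\mathbb F_q^d}\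 \sum_{\theta\in O_d(\mathbb F_q)}\ \prod_{v\in S_0}\ \sum_{\substack{x,x'\in E\\ x-\theta x'=w}}\ \prod_{S'\in\mathcal B(S_0,v)}D_{S',v}(x,x').$$ Let $p(\mathcal T)=p(\mathcal T,S_0)\in[-\infty,\infty]$ be the infimum of the $s\in\mathbb R$ such that $$R_{(\mathcal T,S_0)}\lesssim |E|^{2|V(\mathcal T)|}\,q^{-c(\mathcal T)}\quad\text{whenever } |E|\gtrsim q^s$$ (that is, for every implied constant in the hypothesis there is one in the conclusion). **Lemma (Simplex Unbalancing).** Let $(\mathcal T,S_0)$ be a rooted simplex tree, and let $S_1\neq S_2$ be two simplices of $\mathcal T$ (one of which may be the root), each of dimension at least $2$ and with at least one free vertex. Let $k_1,k_2$ be positive integers such that $k_i$ does not exceed the number of free vertices of $S_i$. Let $(\mathcal T_1,S_0)$ be obtained by deleting $k_2$ free vertices of $S_2$ and adding $k_2$ free vertices to $S_1$, and let $(\mathcal T_2,S_0)$ be obtained by deleting $k_1$ free vertices of $S_1$ and adding $k_1$ free vertices to $S_2$. Then $$p(\mathcal T)\ \le\ \max\bigl(p(\mathcal T_1),\,p(\mathcal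 T_2)\bigr).$$ -/

import Mathlib

open scoped Matrix

/-! ## Simplex trees -/

/-- A rooted (connected) simplex tree: a finite family of simplices, each given by its nonempty
finite vertex set, such that distinct simplices share at most one vertex, any two simplices are
joined by a path of simplices with consecutive members sharing a vertex, and there is no closed
loop of simplices. A closed loop consists of at least three distinct simplices in cyclic order
whose consecutive members meet in distinct vertices; so several simplices may be
attached at one and the same vertex. -/
structure RootedSimplexTree (ι V : Type*) [DecidableEq V] where
  /-- the vertex set of each simplex -/
  simplex : ι → Finset V
  /-- the root simplex -/
  root : ι
  nonempty : ∀ i, (simplex i).Nonempty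
  card_inter_le_one : ∀ i j, i ≠ j → (simplex i ∩ simplex j).card ≤ 1
  connected : ∀ i j, Relation.ReflTransGen (fun a b => (simplex a ∩ simplex b).Nonempty) i j
  no_loop : ∀ n : ℕ, 3 ≤ n → ∀ (i : ZMod n → ι) (v : ZMod n → V),
    Function.Injective i → Function.Injective v →
      ¬ ∀ j, v j ∈ simplex (i j) ∩ simplex (i (j + 1))

namespace RootedSimplexTree

variable {ι V : Type*} [DecidableEq V]

/-- The dimension of a simplex: the number of its vertices minus one. -/
def dim (T : RootedSimplexTree ι V) (i : ι) : ℕ := (T.simplex i).card - 1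

/-- The vertex set `V(T)` of the tree. -/
def vertices [Fintype ι] (T : RootedSimplexTree ι V) : Finset V := Finset.univ.biUnion T.simplex

/-- The free vertices of a simplex: those shared by no other simplex. -/
def freeVertices [Fintype ι] [DecidableEq ι] (T : RootedSimplexTree ι V) (i : ι) : Finset V :=
  (T.simplex i).filter fun v => ∀ j, j ≠ i → v ∉ T.simplex j

/-- The graph on the simplices in which neighbours are the simplices sharing a vertex. -/
def adjGraph (T : RootedSimplexTree ι V) : SimpleGraph ι where
  Adj i j := i ≠ j ∧ (T.simplex i ∩ T.simplex j).Nonempty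
  symm := ⟨fun i j h => ⟨h.1.symm, by rw [Finset.inter_comm]; exact h.2⟩⟩
  loopless := ⟨fun _ h => h.1 rfl⟩

/-- The depth of a simplex: the minimal length of a path of simplices from the root to it. -/
noncomputable def depth (T : RootedSimplexTree ι V) (i : ι) : ℕ := T.adjGraph.dist T.root i

/-- The roots of the branches of the simplex `i` at its vertex `v`: the simplices of greater
depth containing `v`. -/
noncomputable def branchRoots [Fintype ι] (T : RootedSimplexTree ι V) (i : ι) (v : V) : Finset ι :=
  Finset.univ.filter fun j => v ∈ T.simplex j ∧ T.depth i < T.depth j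

theorem inter_move [DecidableEq ι] (S : ι → Finset V) {a b : ι} (hab : a ≠ b) {X : Finset V}
    (hX : ∀ v ∈ X, v ∈ S b ∧ ∀ j, j ≠ b → v ∉ S j) (i j : ι) (hij : i ≠ j) :
    (if i = a then S a ∪ X else if i = b then S b \ X else S i) ∩
      (if j = a then S a ∪ X else if j = b then S b \ X else S j) = S i ∩ S j := by
  ext v
  by_cases hv : v ∈ X
  · obtain ⟨hb, hn⟩ := hX v hv
    have key : ∀ k, v ∈ (if k = a then S a ∪ X else if k = b then S b \ X else S k) ↔ k = a := by
      intro k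
      by_cases h1 : k = a
      · simp [h1, hv]
      · by_cases h2 : k = b
        · simp [h2, hab.symm, hv]
        · simp [h1, h2, hn k h2]
    have key2 : ∀ k, v ∈ S k ↔ k = b := by
      intro k
      by_cases h : k = b
      · simp [h, hb]
      · simp [h, hn k h]
    simp only [Finset.mem_inter, key, key2]
    constructor
    · rintro ⟨rfl, rfl⟩; exact absurd rfl hij
    · rintro ⟨rfl, rfl⟩; exact absurd rfl hij
  · have key : ∀ k, v ∈ (if k = a then S a ∪ X else if k = b then S b \ X else S k) ↔ v ∈ S k := by
      intro k
      by_cases h1 : k = a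
      · simp [h1, hv]
      · by_cases h2 : k = b
        · simp [h2, hab.symm, hv]
        · simp [h1, h2]
    simp only [Finset.mem_inter, key]

/-- The rooted simplex tree obtained by deleting the free vertices `X` of the simplex `b` and
adding equally many free vertices to the simplex `a`; the new free vertices of `a` are again called
`X`. The root and all other simplices stay as they are. -/
def moveFree [Fintype ι] [DecidableEq ι] (T : RootedSimplexTree ι V) (a b : ι) (hab : a ≠ b) (X : Finset V)
    (hX : X ⊆ T.freeVertices b) : RootedSimplexTree ι V :=
  have hX' : ∀ v ∈ X, v ∈ T.simplex b ∧ ∀ j, j ≠ b → v ∉ T.simplex j := fun v hv => by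
    simpa [freeVertices] using hX hv
  have hne : ∀ i, (if i = a then T.simplex a ∪ X else
      if i = b then T.simplex b \ X else T.simplex i).Nonempty := fun i => by
    by_cases h1 : i = a
    · simp only [h1, if_true]
      exact (T.nonempty a).mono Finset.subset_union_left
    · by_cases h2 : i = b
      · subst h2
        simp only [if_neg h1, if_true]
        have aux : ∀ c, Relation.ReflTransGen
            (fun x y => (T.simplex x ∩ T.simplex y).Nonempty) i c → c ≠ i →
            ∃ v ∈ T.simplex i, ∃ j, j ≠ i ∧ v ∈ T.simplex j := by
          intro c hc
          induction hc with
          | refl => exact fun h => absurd rfl h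
          | @tail x y _ hxy ih =>
            intro hy
            by_cases hx : x = i
            · obtain ⟨v, hv⟩ := hxy
              rw [Finset.mem_inter, hx] at hv
              exact ⟨v, hv.1, y, hy, hv.2⟩
            · exact ih hx
        obtain ⟨v, hv, j, hj, hvj⟩ := aux a (T.connected i a) hab
        exact ⟨v, Finset.mem_sdiff.2 ⟨hv, fun h => (hX' v h).2 j hj hvj⟩⟩
      · simp only [if_neg h1, if_neg h2]
        exact T.nonempty i
  { simplex := fun i => if i = a then T.simplex a ∪ X else
      if i = b then T.simplex b \ X else T.simplex i
    root := T.root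
    nonempty := hne
    card_inter_le_one := fun i j hij => by
      rw [inter_move T.simplex hab hX' i j hij]
      exact T.card_inter_le_one i j hij
    connected := fun i j => by
      refine Relation.ReflTransGen.mono (fun x y hxy => ?_) _ _ (T.connected i j)
      by_cases h : x = y
      · subst h
        rw [Finset.inter_self]
        exact hne x
      · rw [inter_move T.simplex hab hX' x y h]
        exact hxy
    no_loop := fun n hn i v hi hv h => by
      refine T.no_loop n hn i v hi hv fun j => ?_
      have h1 : i j ≠ i (j + 1) := fun e => by
        have : Fact (1 < n) := ⟨by omega⟩
        have h2 : j = j + 1 := hi e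
        exact one_ne_zero (left_eq_add.1 h2)
      have h2 := h j
      rwa [inter_move T.simplex hab hX' _ _ h1] at h2 }

end RootedSimplexTree

/-! ## Congruence classes and stabilizers over a finite field -/

section FiniteField

variable (F : Type) [Field F] [Fintype F]

/-- The "distance" `‖x - y‖ = (x₁ - y₁)² + ⋯ + (x_d - y_d)²`. -/
def sqDist {F : Type} [Field F] {d : ℕ} (x y : Fin d → F) : F := ∑ k, (x k - y k) ^ 2

/-- Congruence of embeddings of an `n`-simplex (the complete graph on `n + 1` vertices) in `F^d`:
all the edges have the same lengths. -/
def simplexCongr (d n : ℕ) : Setoid (Fin (n + 1) → Fin d → F) where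
  r x y := ∀ i j, sqDist (x i) (x j) = sqDist (y i) (y j)
  iseqv := ⟨fun _ _ _ => rfl, fun h i j => (h i j).symm, fun h h' i j => (h i j).trans (h' i j)⟩

/-- The number of congruence classes of `n`-simplices in `F^d`. -/
noncomputable def numCongrClasses (d n : ℕ) : ℕ := Nat.card (Quotient (simplexCongr F d n))

/-- `Stab(n)`: the minimal size, over all `n`-simplices `(y₀, …, yₙ)` in `F^d`, of the stabilizer
of `(0, y₁ - y₀, …, yₙ - y₀)` in the orthogonal group `O_d(F)`. -/
noncomputable def minStab (d n : ℕ) : ℕ :=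
  ⨅ y : Fin (n + 1) → Fin d → F,
    Nat.card {θ : Matrix.orthogonalGroup (Fin d) F //
      ∀ i, (θ : Matrix (Fin d) (Fin d) F) *ᵥ (y i - y 0) = y i - y 0}

/-- The pairs `(x, x')` of points of `E` with `x - θ x' = w`. -/
noncomputable def motionPairs {F : Type} [Field F] {d : ℕ} (E : Finset (Fin d → F))
    (θ : Matrix (Fin d) (Fin d) F) (w : Fin d → F) : Finset ((Fin d → F) × (Fin d → F)) := by
  classical
  exact (E ×ˢ E).filter fun y => y.1 - θ *ᵥ y.2 = w

/-- The orthogonal group `O_d(F)` over a finite field is finite. -/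
noncomputable instance orthogonalFintype (d : ℕ) : Fintype (Matrix.orthogonalGroup (Fin d) F) :=
  Fintype.ofFinite _

end FiniteField

/-- `q ^ c` is the order of magnitude of the number of congruence classes of `n`-simplices in
`𝔽_q^d`, as `q` runs over the odd prime powers. -/
def IsClassExponent (d n : ℕ) (c : ℤ) : Prop :=
  ∃ A B : ℝ, 0 < A ∧ 0 < B ∧ ∀ (F : Type) [Field F] [Fintype F], ringChar F ≠ 2 →
    A * (Fintype.card F : ℝ) ^ c ≤ (numCongrClasses F d n : ℝ) ∧
      (numCongrClasses F d n : ℝ) ≤ B * (Fintype.card F : ℝ) ^ c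

/-- The integer `c_d(S)`, for a simplex `S` of dimension `n`, such that the number of congruence
classes of `S` in `𝔽_q^d` is on the order of `q ^ c_d(S)`. -/
noncomputable def classExponent (d n : ℕ) : ℤ := Classical.epsilon (IsClassExponent d n)

/-! ## The sums `D` and `R` attached to a rooted simplex tree, and the threshold `p` -/

namespace RootedSimplexTree

variable {ι V : Type*} [Fintype ι] [DecidableEq V]
variable {F : Type} [Field F] [Fintype F] {d : ℕ}

/-- `D_{P(S)}(u, u')` for the subtree `P(S)` consisting of the simplex `S` with index `i` and
everything hanging below it, with designated vertex `v₀` of `S`. It is the recursively defined sum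
`Stab(dim S)⁻¹ ∑_θ ∏_{v ∈ S, v ≠ v₀} ∑_{x, x' ∈ E, x - θ x' = u - θ u'} ∏_B D_B(x, x')`,
with `B` running through the branches of `S` at `v`. -/
noncomputable def branchSum (T : RootedSimplexTree ι V) (E : Finset (Fin d → F))
    (i : ι) (v₀ : V) (u u' : Fin d → F) : ℝ :=
  (minStab F d (T.dim i) : ℝ)⁻¹ * ∑ θ : Matrix.orthogonalGroup (Fin d) F,
    ∏ v ∈ (T.simplex i).erase v₀,
      ∑ y ∈ motionPairs E θ (u - (θ : Matrix (Fin d) (Fin d) F) *ᵥ u'),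
        ∏ j ∈ (T.branchRoots i v).attach, T.branchSum E j.1 v y.1 y.2
termination_by (Finset.univ.filter fun j => T.depth i < T.depth j).card
decreasing_by
  have hj : T.depth i < T.depth j.1 := (Finset.mem_filter.1 j.2).2.2
  refine Finset.card_lt_card ⟨fun k hk => ?_, fun hsub => ?_⟩
  · simp only [Finset.mem_filter, Finset.mem_univ, true_and] at hk ⊢
    exact hj.trans hk
  · have h := hsub (Finset.mem_filter.2 ⟨Finset.mem_univ j.1, hj⟩)
    simp at h

theorem branchSum_eq (T : RootedSimplexTree ι V) (E : Finset (Fin d → F))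
    (i : ι) (v₀ : V) (u u' : Fin d → F) :
    T.branchSum E i v₀ u u' =
      (minStab F d (T.dim i) : ℝ)⁻¹ * ∑ θ : Matrix.orthogonalGroup (Fin d) F,
        ∏ v ∈ (T.simplex i).erase v₀,
          ∑ y ∈ motionPairs E θ (u - (θ : Matrix (Fin d) (Fin d) F) *ᵥ u'),
            ∏ j ∈ T.branchRoots i v, T.branchSum E j v y.1 y.2 := by
  rw [branchSum]
  congr 1
  refine Finset.sum_congr rfl fun θ _ => Finset.prod_congr rfl fun v _ =>
    Finset.sum_congr rfl fun y _ => ?_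
  exact Finset.prod_attach (T.branchRoots i v) fun j => T.branchSum E j v y.1 y.2

/-- `R_{(T, S₀)} = Stab(dim S₀)⁻¹ ∑_w ∑_θ ∏_{v ∈ S₀} ∑_{x, x' ∈ E, x - θ x' = w} ∏_B D_B(x, x')`,
with `B` running through the branches of the root `S₀` at `v`. -/
noncomputable def rootSum (T : RootedSimplexTree ι V) (E : Finset (Fin d → F)) : ℝ :=
  (minStab F d (T.dim T.root) : ℝ)⁻¹ *
    ∑ w : Fin d → F, ∑ θ : Matrix.orthogonalGroup (Fin d) F,
      ∏ v ∈ T.simplex T.root, ∑ y ∈ motionPairs E θ w,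
        ∏ j ∈ T.branchRoots T.root v, T.branchSum E j v y.1 y.2

/-- `c(T)`, the sum of `c_d(S)` over all simplices `S` of `T`. -/
noncomputable def treeExponent (T : RootedSimplexTree ι V) (d : ℕ) : ℤ :=
  ∑ i, classExponent d (T.dim i)

/-- `R_{(T, S₀)} ≲ |E|^{2|V(T)|} q^{-c(T)}` holds for subsets `E` of `𝔽_q^d` whenever
`|E| ≳ q^s`: for every implied constant `A` in the hypothesis there is one, `B`, in the conclusion,
which is independent of `q` and `E`. Here `q` runs over the odd prime powers. -/
def BoundHolds (T : RootedSimplexTree ι V) (d : ℕ) (s : ℝ) : Prop :=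
  ∀ A : ℝ, 0 < A → ∃ B : ℝ, ∀ (F : Type) [Field F] [Fintype F], ringChar F ≠ 2 →
    ∀ E : Finset (Fin d → F), A * (Fintype.card F : ℝ) ^ s ≤ (E.card : ℝ) →
      T.rootSum E ≤
        B * ((E.card : ℝ) ^ (2 * T.vertices.card) * (Fintype.card F : ℝ) ^ (-T.treeExponent d))

/-- `p(T, S₀)`: the infimum of the real numbers `s` for which the bound holds whenever
`|E| ≳ q^s`. The infimum is taken in the extended reals. -/
noncomputable def threshold (T : RootedSimplexTree ι V) (d : ℕ) : EReal :=
  ⨅ s : {s : ℝ // T.BoundHolds d s}, ((s : ℝ) : EReal)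

end RootedSimplexTree

/-! The proof interpolates between the two modified trees by Hölder's inequality. Let `Z` be the set
of all free vertices that are moved. In `T` and in both modified trees these vertices carry no
branches, so in the sums `D` and `R` each contributes only the number of pairs in `E` with the given
displacement. The three trees otherwise have the same root, depths and branches. With weights `r =
k₁/(k₁+k₂)` and `t = k₂/(k₁+k₂)`, the number of vertices of `Z` in each simplex of `T` is the
weighted mean of the numbers in the two modified trees. Hölder, applied to every sum from the leaves
up to the root, therefore bounds the root sum of `T` by the product of the `r`-th and `t`-th powers
of the other two root sums, up to stabilizer factors (`rootSum_le`).

Each simplex contributes one factor `Stab(n)⁻¹ Stab(a)^r Stab(b)^t`, where `n = r a + t b` are its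
dimensions in the three trees. Its size is governed by `exists_minStab_comparable`: `Stab(n)` is of
order `q` to the power `c_d(n)` plus an affine function of `n`. The affine part cancels in the
weighted mean, leaving `q^(-c_d(n) + r c_d(a) + t c_d(b))`. Multiplied over the tree, this is
precisely the factor that turns the bounds for the modified trees into the bound for `T`, as moving
vertices preserves their total number.

Two supporting facts take up most of the work. The size of `Stab(n)` comes from counting frames with
prescribed Gram matrix, orthogonal matrices and congruence classes, with constants uniform in `q`.
That each simplex contributes its factor exactly once rests on the acyclicity of the incidence
graph, which makes the parent of a simplex unique. -/

/-! ### Counting vectors and frames with prescribed inner products -/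

section SphereCount

variable {F : Type} [Field F]

/-- The standard inner product on `F^d` as a bilinear form. -/
abbrev dotForm (F : Type) [Field F] (d : ℕ) : LinearMap.BilinForm F (Fin d → F) :=
  dotProductBilin F F

theorem dotForm_nondegenerate (d : ℕ) : (dotForm F d).Nondegenerate := by
  refine ⟨fun v hv => ?_, fun v hv => ?_⟩
  · exact dotProduct_eq_zero v hv
  · exact dotProduct_eq_zero v fun w => by rw [dotProduct_comm]; exact hv w

theorem dotForm_isRefl (d : ℕ) : (dotForm F d).IsRefl := fun v w h => by
  change w ⬝ᵥ v = 0
  rw [dotProduct_comm]; exact h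

/-- The vectors orthogonal to a given family. -/
def perpSpace {d k : ℕ} (y : Fin k → Fin d → F) : Submodule F (Fin d → F) :=
  LinearMap.BilinForm.orthogonal (dotForm F d)
    (Submodule.span F (Set.range y))

theorem mem_perpSpace {d k : ℕ} {y : Fin k → Fin d → F} {u : Fin d → F} :
    u ∈ perpSpace y ↔ ∀ i, u ⬝ᵥ y i = 0 := by
  constructor
  · intro h i
    rw [dotProduct_comm]
    exact h (y i) (Submodule.subset_span ⟨i, rfl⟩)
  · intro h w hw
    change w ⬝ᵥ u = 0
    induction hw using Submodule.span_induction with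
    | mem x hx => obtain ⟨i, rfl⟩ := hx; rw [dotProduct_comm]; exact h i
    | zero => exact zero_dotProduct _
    | add x z _ _ hx hz => rw [add_dotProduct, hx, hz, add_zero]
    | smul a x _ hx => rw [smul_dotProduct, hx, smul_zero]

theorem mem_span_of_dotProduct_perpSpace {d k : ℕ} {y : Fin k → Fin d → F} {v : Fin d → F}
    (h : ∀ u ∈ perpSpace y, v ⬝ᵥ u = 0) : v ∈ Submodule.span F (Set.range y) := by
  rw [← LinearMap.BilinForm.orthogonal_orthogonal (dotForm_nondegenerate d)
    (dotForm_isRefl d) (Submodule.span F (Set.range y))]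
  intro u hu
  change u ⬝ᵥ v = 0
  rw [dotProduct_comm]; exact h u hu

variable [Fintype F]

theorem card_perpSpace {d k : ℕ} {y : Fin k → Fin d → F} (hy : LinearIndependent F y) :
    Nat.card (perpSpace y) = Fintype.card F ^ (d - k) := by
  classical
  have : Fintype (perpSpace y) := Fintype.ofFinite _
  rw [Nat.card_eq_fintype_card, Module.card_eq_pow_finrank (K := F), perpSpace,
    LinearMap.BilinForm.finrank_orthogonal (dotForm_nondegenerate d),
    finrank_span_eq_card hy]
  simp

/-- Choose a direction `u` orthogonal to the `y i` such that every line `v + F u` through a solution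
meets the solution set at most twice. Then `(v, t) ↦ v - v₀ + t u` is at most two-to-one into the
orthogonal space. Solutions in the span must be excluded: if the orthogonal space is totally
isotropic, one such solution yields a whole translate of it. -/
theorem ncard_sphere_mul_card_le (hF : ringChar F ≠ 2) {d k : ℕ} {y : Fin k → Fin d → F}
    (hy : LinearIndependent F y) (g : Fin k → F) (c : F) :
    {v : Fin d → F | v ∉ Submodule.span F (Set.range y) ∧ (∀ i, v ⬝ᵥ y i = g i) ∧
      v ⬝ᵥ v = c}.ncard * Fintype.card F ≤ 2 * Fintype.card F ^ (d - k) := by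
  classical
  have h2 : (2 : F) ≠ 0 := Ring.two_ne_zero hF
  set Q := {v : Fin d → F | v ∉ Submodule.span F (Set.range y) ∧ (∀ i, v ⬝ᵥ y i = g i) ∧
      v ⬝ᵥ v = c} with hQ
  rcases Q.eq_empty_or_nonempty with h0 | ⟨v₀, hv₀⟩
  · simp [h0]
  have hdiff : ∀ v ∈ Q, v - v₀ ∈ perpSpace y := fun v hv => mem_perpSpace.2 fun i => by
    rw [sub_dotProduct, hv.2.1, hv₀.2.1, sub_self]
  -- Any anisotropic `u` works. If there is none, some `u` pairs nontrivially with `v₀`, because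
  -- `v₀` is outside the span; total isotropy then makes `v ⬝ᵥ u` constant over all solutions.
  obtain ⟨u, huL, hu⟩ : ∃ u ∈ perpSpace y, ∀ v ∈ Q, u ⬝ᵥ u ≠ 0 ∨ v ⬝ᵥ u ≠ 0 := by
    by_cases hL : ∃ u ∈ perpSpace y, u ⬝ᵥ u ≠ 0
    · obtain ⟨u, hu, h⟩ := hL
      exact ⟨u, hu, fun _ _ => Or.inl h⟩
    · push Not at hL
      obtain ⟨u, hu, h⟩ : ∃ u ∈ perpSpace y, v₀ ⬝ᵥ u ≠ 0 := by
        by_contra! hc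
        exact hv₀.1 (mem_span_of_dotProduct_perpSpace hc)
      refine ⟨u, hu, fun v hv => Or.inr ?_⟩
      have h1 := hL _ ((perpSpace y).add_mem (hdiff v hv) hu)
      rw [add_dotProduct, dotProduct_add, dotProduct_add, hL _ hu, hL _ (hdiff v hv),
        dotProduct_comm u, zero_add, add_zero, ← two_mul] at h1
      have h3 := (mul_eq_zero.1 h1).resolve_left h2
      rw [sub_dotProduct, sub_eq_zero] at h3
      rwa [h3]
  let f : (Fin d → F) × F → (Fin d → F) := fun p => p.1 - v₀ + p.2 • u
  have hmaps : ∀ p ∈ Q.toFinset ×ˢ (Finset.univ : Finset F),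
      f p ∈ (perpSpace y : Set (Fin d → F)).toFinset := by
    intro p hp
    simp only [Finset.mem_product, Set.mem_toFinset] at hp
    rw [Set.mem_toFinset]
    exact (perpSpace y).add_mem (hdiff _ hp.1) ((perpSpace y).smul_mem _ huL)
  have key := Finset.card_le_mul_card_image_of_maps_to hmaps 2 fun w _ => by
    rcases ({p ∈ Q.toFinset ×ˢ (Finset.univ : Finset F) | f p = w}).eq_empty_or_nonempty with
      h0 | ⟨⟨v, t⟩, hp⟩
    · simp [h0]
    simp only [Finset.mem_filter, Finset.mem_product, Set.mem_toFinset, Finset.mem_univ,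
      and_true, f] at hp
    obtain ⟨hv, hw⟩ := hp
    -- The second point is the reflection of the first along `u`. When `u ⬝ᵥ u = 0` the quotient is
    -- `0` and the two points coincide, in accordance with the equation for `s` being linear.
    have hsub : {p ∈ Q.toFinset ×ˢ (Finset.univ : Finset F) | f p = w} ⊆
        {(v, t), (v + (-2 * (v ⬝ᵥ u) / (u ⬝ᵥ u)) • u, t - (-2 * (v ⬝ᵥ u) / (u ⬝ᵥ u)))} := by
      rintro ⟨v', t'⟩ hp'
      simp only [Finset.mem_filter, Finset.mem_product, Set.mem_toFinset, Finset.mem_univ,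
        and_true, f] at hp'
      obtain ⟨hv', hw'⟩ := hp'
      obtain ⟨s, hs⟩ : ∃ s, s = t - t' := ⟨_, rfl⟩
      have e1 : v' = v + s • u := by
        have : v' - v₀ + t' • u = v - v₀ + t • u := hw'.trans hw.symm
        rw [hs, sub_smul]
        linear_combination (exp := 1) this
      have ht' : t' = t - s := by rw [hs]; ring
      have e2 : s * (2 * (v ⬝ᵥ u) + s * (u ⬝ᵥ u)) = 0 := by
        have h1 := hv'.2.2
        rw [e1, add_dotProduct, dotProduct_add, dotProduct_add, hv.2.2] at h1
        simp only [smul_dotProduct, dotProduct_smul, smul_eq_mul, dotProduct_comm u v] at h1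
        linear_combination h1
      simp only [Finset.mem_insert, Finset.mem_singleton, Prod.mk.injEq]
      rcases mul_eq_zero.1 e2 with h | h
      · left
        subst h
        simp [e1, ht']
      · right
        have huu : u ⬝ᵥ u ≠ 0 := by
          intro h0
          rw [h0, mul_zero, add_zero] at h
          rcases hu v hv with h' | h'
          · exact h' h0
          · exact h' ((mul_eq_zero.1 h).resolve_left h2)
        have : s = -2 * (v ⬝ᵥ u) / (u ⬝ᵥ u) := by
          rw [eq_div_iff huu]; linear_combination h
        rw [← this]
        exact ⟨e1, ht'⟩
    exact (Finset.card_le_card hsub).trans Finset.card_le_two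
  rw [Finset.card_product, Finset.card_univ] at key
  have e3 : (perpSpace y : Set (Fin d → F)).toFinset.card = Fintype.card F ^ (d - k) := by
    rw [← card_perpSpace hy, Set.toFinset_card, ← Nat.card_eq_fintype_card]; rfl
  rw [e3, ← Set.ncard_eq_toFinset_card'] at key
  exact key

theorem ncard_sphere_le (hF : ringChar F ≠ 2) {d k : ℕ} {y : Fin k → Fin d → F}
    (hy : LinearIndependent F y) (g : Fin k → F) (c : F) :
    {v : Fin d → F | v ∉ Submodule.span F (Set.range y) ∧ (∀ i, v ⬝ᵥ y i = g i) ∧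
      v ⬝ᵥ v = c}.ncard ≤ 2 * Fintype.card F ^ (d - 1 - k) := by
  have hq : 0 < Fintype.card F := Fintype.card_pos
  rcases lt_or_ge k d with hk | hk
  · have h := ncard_sphere_mul_card_le hF hy g c
    obtain ⟨e, rfl⟩ : ∃ e, d = k + 1 + e := ⟨d - (k + 1), by omega⟩
    rw [show k + 1 + e - k = e + 1 by omega, pow_succ, ← mul_assoc] at h
    rw [show k + 1 + e - 1 - k = e by omega]
    exact Nat.le_of_mul_le_mul_right h hq
  -- Here the truncated exponent is harmless, since independent vectors numbering at least `d` span
  -- and no solution remains.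
  · have hspan : Submodule.span F (Set.range y) = ⊤ := by
      apply Submodule.eq_top_of_finrank_eq
      refine le_antisymm (Submodule.finrank_le _) ?_
      rw [finrank_span_eq_card hy]
      simpa using hk
    have : {v : Fin d → F | v ∉ Submodule.span F (Set.range y) ∧ (∀ i, v ⬝ᵥ y i = g i) ∧
      v ⬝ᵥ v = c} = ∅ := by
      ext v; simp [hspan]
    rw [this]; simp

/-- The linearly independent `k`-tuples of vectors with prescribed inner products whose first `m`
members are prescribed. -/
def frameSet (g : ℕ → ℕ → F) (d : ℕ) (z : ℕ → Fin d → F) (m k : ℕ) : Set (Fin k → Fin d → F) :=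
  {y | LinearIndependent F y ∧ (∀ i j : Fin k, y i ⬝ᵥ y j = g i j) ∧ ∀ i : Fin k, (i : ℕ) < m → y i = z i}

/-- Frames are built one vector at a time: given `k` independent vectors, the next one lies on a
sphere section counted by `ncard_sphere_le`. -/
theorem ncard_frameSet_le (hF : ringChar F ≠ 2) (g : ℕ → ℕ → F) {d : ℕ} (z : ℕ → Fin d → F)
    {m k : ℕ} (hmk : m ≤ k) :
    (frameSet g d z m k).ncard ≤
      2 ^ (k - m) * Fintype.card F ^ ∑ j ∈ Finset.Ico m k, (d - 1 - j) := by
  classical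
  induction k, hmk using Nat.le_induction with
  | base =>
    simp only [Nat.sub_self, pow_zero, Finset.Ico_self, Finset.sum_empty, mul_one]
    refine (Set.ncard_le_one_iff (Set.toFinite _)).2 fun {a b} ha hb => ?_
    funext i
    rw [ha.2.2 i i.2, hb.2.2 i i.2]
  | succ k hmk ih =>
    have hmaps : ∀ y ∈ (frameSet g d z m (k + 1)).toFinset,
        (Fin.init y : Fin k → Fin d → F) ∈ (frameSet g d z m k).toFinset := by
      intro y hy
      rw [Set.mem_toFinset] at hy ⊢
      exact ⟨(linearIndependent_finSucc'.1 hy.1).1, fun i j => hy.2.1 i.castSucc j.castSucc,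
        fun i hi => hy.2.2 i.castSucc hi⟩
    have key := Finset.card_le_mul_card_image_of_maps_to hmaps
      (2 * Fintype.card F ^ (d - 1 - k)) fun y hy => by
        rw [Set.mem_toFinset] at hy
        refine le_trans ?_ (ncard_sphere_le hF hy.1 (fun i => g k i) (g k k))
        rw [Set.ncard_eq_toFinset_card']
        refine Finset.card_le_card_of_injOn (fun w => w (Fin.last k)) ?_ ?_
        · intro w hw
          simp only [Finset.coe_filter, Set.mem_toFinset, Set.mem_ofPred_eq] at hw
          obtain ⟨hw, rfl⟩ := hw
          simp only [Set.coe_toFinset, Set.mem_ofPred_eq]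
          refine ⟨(linearIndependent_finSucc'.1 hw.1).2, fun i => ?_, ?_⟩
          · have := hw.2.1 (Fin.last k) i.castSucc
            simpa [Fin.init] using this
          · simpa using hw.2.1 (Fin.last k) (Fin.last k)
        · intro w hw w' hw' h
          simp only [Finset.coe_filter, Set.mem_toFinset, Set.mem_ofPred_eq] at hw hw'
          rw [← Fin.snoc_init_self w, ← Fin.snoc_init_self w', hw.2, hw'.2]
          exact congrArg _ h
    rw [← Set.ncard_eq_toFinset_card', ← Set.ncard_eq_toFinset_card'] at key
    refine key.trans ((Nat.mul_le_mul_left _ ih).trans (le_of_eq ?_))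
    rw [Finset.sum_Ico_succ_top hmk, show k + 1 - m = (k - m) + 1 by omega]
    ring

end SphereCount

/-! ### A lower bound for the orthogonal group by the Cayley transform -/

section Orthogonal

/-- The skew-symmetric matrix with given entries above the diagonal. -/
def skewMatrix {R : Type*} [CommRing R] {d : ℕ} (x : {p : Fin d × Fin d // p.1 < p.2} → R) :
    Matrix (Fin d) (Fin d) R :=
  Matrix.of fun i j => if h : i < j then x ⟨(i, j), h⟩ else if h : j < i then -x ⟨(j, i), h⟩ else 0

theorem skewMatrix_transpose {R : Type*} [CommRing R] {d : ℕ}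
    (x : {p : Fin d × Fin d // p.1 < p.2} → R) : (skewMatrix x)ᵀ = -skewMatrix x := by
  ext i j
  rcases lt_trichotomy i j with h | h | h
  · simp [skewMatrix, h, h.not_gt]
  · simp [skewMatrix, h]
  · simp [skewMatrix, h, h.not_gt]

theorem skewMatrix_injective {R : Type*} [CommRing R] {d : ℕ} :
    Function.Injective (skewMatrix : ({p : Fin d × Fin d // p.1 < p.2} → R) → _) := by
  intro x y h
  funext ⟨⟨i, j⟩, hij⟩
  have := congrFun (congrFun h i) j
  simpa [skewMatrix, show i < j from hij] using this

variable {F : Type} [Field F]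

theorem cayley_mem_orthogonalGroup {d : ℕ} {A : Matrix (Fin d) (Fin d) F} (hA : Aᵀ = -A)
    (hdet : IsUnit (1 + A).det) : (1 - A) * (1 + A)⁻¹ ∈ Matrix.orthogonalGroup (Fin d) F := by
  rw [Matrix.mem_orthogonalGroup_iff']
  have hdet' : IsUnit (1 - A).det := by
    have : (1 + A)ᵀ = 1 - A := by rw [Matrix.transpose_add, hA, Matrix.transpose_one]; abel
    rwa [← this, Matrix.det_transpose]
  have h1 : ((1 - A) * (1 + A)⁻¹)ᵀ = (1 - A)⁻¹ * (1 + A) := by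
    rw [Matrix.transpose_mul, Matrix.transpose_nonsing_inv, Matrix.transpose_sub,
      Matrix.transpose_add, hA, Matrix.transpose_one]
    congr 2 <;> abel
  have hc : (1 + A) * (1 - A) = (1 - A) * (1 + A) := by noncomm_ring
  rw [h1, Matrix.mul_assoc, ← Matrix.mul_assoc (1 + A), hc, Matrix.mul_assoc (1 - A),
    Matrix.mul_nonsing_inv _ hdet, Matrix.mul_one, Matrix.nonsing_inv_mul _ hdet']

/-- The transform equals `2 (1 + C)⁻¹ - 1`, from which `C` can be recovered when `2` is invertible.
-/
theorem cayley_injective (h2 : (2 : F) ≠ 0) {d : ℕ} {A B : Matrix (Fin d) (Fin d) F}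
    (hA : IsUnit (1 + A).det) (hB : IsUnit (1 + B).det)
    (h : (1 - A) * (1 + A)⁻¹ = (1 - B) * (1 + B)⁻¹) : A = B := by
  have key : ∀ C : Matrix (Fin d) (Fin d) F, IsUnit (1 + C).det →
      (1 - C) * (1 + C)⁻¹ = (2 : F) • (1 + C)⁻¹ - 1 := by
    intro C hC
    have : (1 - C) = (2 : F) • 1 - (1 + C) := by rw [two_smul]; abel
    rw [this, sub_mul, Matrix.mul_nonsing_inv _ hC, Matrix.smul_mul, Matrix.one_mul]
  rw [key A hA, key B hB, sub_left_inj] at h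
  have h3 : (1 + A)⁻¹ = (1 + B)⁻¹ := by
    have := congrArg (fun M => (2 : F)⁻¹ • M) h
    simpa [smul_smul, h2] using this
  have h4 := congrArg (fun M => M⁻¹) h3
  simp only [Matrix.nonsing_inv_nonsing_inv _ hA, Matrix.nonsing_inv_nonsing_inv _ hB] at h4
  exact add_left_cancel h4

variable [Fintype F]

theorem card_upper_pairs (d : ℕ) :
    Fintype.card {p : Fin d × Fin d // p.1 < p.2} = ∑ j ∈ Finset.range d, (d - 1 - j) := by
  rw [Fintype.card_subtype, Finset.card_filter, ← Finset.univ_product_univ, Finset.sum_product,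
    Finset.sum_range]
  refine Finset.sum_congr rfl fun i _ => ?_
  rw [← Finset.card_filter]
  have : (Finset.univ.filter fun j : Fin d => i < j) = Finset.Ioi i := by ext; simp
  rw [this, Fin.card_Ioi]

/-- The determinant of `1` plus a generic skew matrix is a polynomial of degree at most `d` with
value `1` at the origin, so Schwartz–Zippel applies. -/
theorem card_skew_det_eq_zero_le (d N : ℕ) (e : Fin N ≃ {p : Fin d × Fin d // p.1 < p.2}) :
    letI := Classical.decEq F
    ((Finset.univ.filter fun x : Fin N → F =>
      (1 + skewMatrix (x ∘ e.symm)).det = 0).card : ℚ≥0) / (Fintype.card F : ℚ≥0) ^ N ≤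
      d / Fintype.card F := by
  classical
  let P : Matrix (Fin d) (Fin d) (MvPolynomial (Fin N) F) :=
    1 + skewMatrix fun p => MvPolynomial.X (e.symm p)
  have heval : ∀ x : Fin N → F, MvPolynomial.eval x P.det = (1 + skewMatrix (x ∘ e.symm)).det := by
    intro x
    rw [RingHom.map_det]
    congr 1
    ext i j
    simp only [P, skewMatrix, RingHom.mapMatrix_apply, Matrix.map_apply, Matrix.add_apply,
      Matrix.of_apply, map_add, Function.comp]
    congr 1
    · by_cases h : i = j <;> simp [Matrix.one_apply, h]
    · split_ifs <;> simp
  have hP : P.det ≠ 0 := by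
    intro h
    have h1 := heval 0
    rw [h, map_zero] at h1
    have : skewMatrix ((0 : Fin N → F) ∘ e.symm) = (0 : Matrix (Fin d) (Fin d) F) := by
      ext i j
      simp [skewMatrix]
    rw [this, add_zero, Matrix.det_one] at h1
    exact zero_ne_one h1
  have hdeg : P.det.totalDegree ≤ d := by
    rw [Matrix.det_apply]
    refine MvPolynomial.totalDegree_finsetSum_le fun σ _ => ?_
    refine (MvPolynomial.totalDegree_smul_le _ _).trans ?_
    refine (MvPolynomial.totalDegree_finsetProd _ _).trans ?_
    refine (Finset.sum_le_card_nsmul _ _ 1 fun i _ => ?_).trans (by simp)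
    simp only [P, Matrix.add_apply, skewMatrix, Matrix.of_apply]
    refine (MvPolynomial.totalDegree_add _ _).trans (max_le ?_ ?_)
    · by_cases h : σ i = i <;> simp [Matrix.one_apply, h]
    · split_ifs <;> simp [MvPolynomial.totalDegree_X]
  have := MvPolynomial.schwartz_zippel_totalDegree hP (Finset.univ : Finset F)
  simp only [heval, Fintype.piFinset_univ, Finset.card_univ] at this
  refine le_trans (le_of_eq ?_) (this.trans ?_)
  · congr
  · gcongr

theorem card_pow_le_card_orthogonalGroup (hF : ringChar F ≠ 2) (d : ℕ) :
    (Fintype.card F) ^ (∑ j ∈ Finset.range d, (d - 1 - j)) ≤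
      (2 * d + 2) ^ (∑ j ∈ Finset.range d, (d - 1 - j) + 1) *
        Nat.card (Matrix.orthogonalGroup (Fin d) F) := by
  classical
  set N := ∑ j ∈ Finset.range d, (d - 1 - j) with hN
  have hpos : 0 < Nat.card (Matrix.orthogonalGroup (Fin d) F) := Nat.card_pos
  -- For `q ≤ 2d` the constant alone suffices. For larger `q` at least half of all skew matrices lie
  -- in the domain of the Cayley transform.
  rcases le_or_gt (Fintype.card F) (2 * d) with hq | hq
  · calc (Fintype.card F) ^ N ≤ (2 * d + 2) ^ N := Nat.pow_le_pow_left (by omega) _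
      _ ≤ (2 * d + 2) ^ (N + 1) := Nat.pow_le_pow_right (by omega) (by omega)
      _ ≤ _ := Nat.le_mul_of_pos_right _ hpos
  have h2 : (2 : F) ≠ 0 := Ring.two_ne_zero hF
  let e : Fin N ≃ {p : Fin d × Fin d // p.1 < p.2} :=
    (Fintype.equivFinOfCardEq (card_upper_pairs d)).symm
  have hz := card_skew_det_eq_zero_le (F := F) d N e
  set Z := Finset.univ.filter fun x : Fin N → F => (1 + skewMatrix (x ∘ e.symm)).det = 0 with hZ
  have hq0 : (0 : ℚ≥0) < Fintype.card F := by exact_mod_cast Fintype.card_pos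
  have hz1 : 2 * Z.card ≤ Fintype.card F ^ N := by
    have hz2 : (Z.card : ℚ≥0) / (Fintype.card F : ℚ≥0) ^ N ≤ d / Fintype.card F := by
      convert hz
    rw [div_le_div_iff₀ (by positivity) hq0] at hz2
    have hz3 : Z.card * Fintype.card F ≤ d * Fintype.card F ^ N := by exact_mod_cast hz2
    have hz4 : (2 * Z.card) * Fintype.card F ≤ Fintype.card F ^ N * Fintype.card F := by
      calc (2 * Z.card) * Fintype.card F = 2 * (Z.card * Fintype.card F) := by ring
        _ ≤ 2 * (d * Fintype.card F ^ N) := by gcongr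
        _ = Fintype.card F ^ N * (2 * d) := by ring
        _ ≤ _ := by gcongr
    exact Nat.le_of_mul_le_mul_right hz4 Fintype.card_pos
  have hcompl : Zᶜ.card + Z.card = Fintype.card F ^ N := by
    rw [Finset.card_compl_add_card]; simp
  have hle : Zᶜ.card ≤ Nat.card (Matrix.orthogonalGroup (Fin d) F) := by
    have hu : ∀ x ∈ Zᶜ, IsUnit (1 + skewMatrix (x ∘ e.symm)).det := fun x hx => by
      rw [isUnit_iff_ne_zero]
      simpa [hZ] using hx
    rw [← Fintype.card_coe, ← Nat.card_eq_fintype_card]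
    refine Nat.card_le_card_of_injective (fun x : {x // x ∈ Zᶜ} =>
      (⟨_, cayley_mem_orthogonalGroup (skewMatrix_transpose (x.1 ∘ e.symm)) (hu x.1 x.2)⟩ :
        Matrix.orthogonalGroup (Fin d) F)) ?_
    intro x y h
    have h1 := cayley_injective h2 (hu x.1 x.2) (hu y.1 y.2) (congrArg Subtype.val h)
    have h3 := skewMatrix_injective h1
    ext i
    have := congrFun h3 (e i)
    simpa using this
  calc Fintype.card F ^ N ≤ 2 * Nat.card (Matrix.orthogonalGroup (Fin d) F) := by
        rw [← hcompl] at hz1 ⊢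
        omega
    _ ≤ _ := by
      gcongr
      calc 2 ≤ (2 * d + 2) ^ 1 := by rw [pow_one]; omega
        _ ≤ _ := Nat.pow_le_pow_right (by omega) (by omega)

end Orthogonal

/-! ### Upper and lower bounds for the minimal stabilizer -/

section Stabilizers

variable {F : Type} [Field F]

theorem orthogonalGroup_dotProduct {d : ℕ} (θ : Matrix.orthogonalGroup (Fin d) F)
    (v w : Fin d → F) :
    ((θ : Matrix (Fin d) (Fin d) F) *ᵥ v) ⬝ᵥ ((θ : Matrix (Fin d) (Fin d) F) *ᵥ w) = v ⬝ᵥ w := by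
  have h := (Matrix.mem_orthogonalGroup_iff' (Fin d) F).1 θ.2
  rw [Matrix.dotProduct_mulVec, Matrix.vecMul_mulVec, h, Matrix.vecMul_one]

theorem orthogonalGroup_mulVec_injective {d : ℕ} (θ : Matrix.orthogonalGroup (Fin d) F) :
    Function.Injective fun v => (θ : Matrix (Fin d) (Fin d) F) *ᵥ v := by
  have h := (Matrix.mem_orthogonalGroup_iff' (Fin d) F).1 θ.2
  intro v w hvw
  have := congrArg (fun u => (θ : Matrix (Fin d) (Fin d) F)ᵀ *ᵥ u) hvw
  simpa [Matrix.mulVec_mulVec, h] using this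

/-- The pointwise stabilizer of a set of vectors in the orthogonal group. -/
def fixator {d : ℕ} (S : Set (Fin d → F)) : Set (Matrix.orthogonalGroup (Fin d) F) :=
  {θ | ∀ v ∈ S, (θ : Matrix (Fin d) (Fin d) F) *ᵥ v = v}

theorem fixator_span {d : ℕ} (S : Set (Fin d → F)) :
    fixator (Submodule.span F S : Set (Fin d → F)) = fixator S := by
  ext θ
  refine ⟨fun h v hv => h v (Submodule.subset_span hv), fun h v hv => ?_⟩
  induction hv using Submodule.span_induction with
  | mem x hx => exact h x hx
  | zero => exact Matrix.mulVec_zero _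
  | add x z _ _ hx hz => rw [Matrix.mulVec_add, hx, hz]
  | smul a x _ hx => rw [Matrix.mulVec_smul, hx]

/-- Degenerate tuples are padded to exactly `min n d` independent vectors; enlarging the span only
shrinks the fixator, as a lower bound for stabilizers requires. -/
theorem exists_linearIndependent_span_ge {d n : ℕ} (v : Fin n → Fin d → F) :
    ∃ z : Fin (min n d) → Fin d → F, LinearIndependent F z ∧
      Submodule.span F (Set.range v) ≤ Submodule.span F (Set.range z) := by
  classical
  obtain ⟨b, hb, hspan, hli⟩ := exists_linearIndependent F (Set.range v)
  have hli : LinearIndepOn F id b := hli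
  let B := hli.extend (Set.subset_univ b)
  have hB : LinearIndepOn F id B := hli.linearIndepOn_extend _
  have hbB : b ⊆ B := hli.subset_extend _
  let bas := Module.Basis.extend hli
  have : Fintype B := FiniteDimensional.fintypeBasisIndex bas
  have hbfin : b.Finite := (Set.finite_range v).subset hb
  have hcardB : B.toFinset.card = d := by
    rw [Set.toFinset_card]
    have := Module.finrank_eq_card_basis bas
    simpa using this.symm
  have hsub : hbfin.toFinset ⊆ B.toFinset := by
    intro x hx
    rw [Set.mem_toFinset]
    exact hbB (hbfin.mem_toFinset.1 hx)
  have hcb : hbfin.toFinset.card ≤ min n d := by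
    refine le_min ?_ ((Finset.card_le_card hsub).trans hcardB.le)
    have h1 : hbfin.toFinset ⊆ Finset.univ.image v := by
      intro x hx
      obtain ⟨i, rfl⟩ := hb (hbfin.mem_toFinset.1 hx)
      simp
    exact (Finset.card_le_card h1).trans (Finset.card_image_le.trans (by simp))
  obtain ⟨U, hbU, hUB, hU⟩ := Finset.exists_subsuperset_card_eq hsub hcb
    (by rw [hcardB]; exact min_le_right _ _)
  let e := (Finset.equivFinOfCardEq hU).symm
  refine ⟨fun i => (e i : Fin d → F), ?_, ?_⟩
  · have h1 : LinearIndepOn F id (U : Set (Fin d → F)) :=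
      hB.mono fun x hx => by simpa using hUB hx
    exact LinearIndependent.comp h1 (fun i => ⟨e i, (e i).2⟩) fun i j h => by
      apply e.injective; exact Subtype.ext (congrArg Subtype.val h)
  · rw [← hspan]
    refine Submodule.span_mono fun x hx => ?_
    exact ⟨e.symm ⟨x, hbU (hbfin.mem_toFinset.2 hx)⟩, by simp⟩

theorem nat_card_stabilizer_eq {d n : ℕ} (y : Fin (n + 1) → Fin d → F) :
    Nat.card {θ : Matrix.orthogonalGroup (Fin d) F //
      ∀ i, (θ : Matrix (Fin d) (Fin d) F) *ᵥ (y i - y 0) = y i - y 0} =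
    (fixator (Set.range fun i : Fin n => y i.succ - y 0)).ncard := by
  rw [← Nat.card_coe_set_eq]
  refine Nat.card_congr (Equiv.subtypeEquivRight fun θ => ?_)
  constructor
  · rintro h _ ⟨i, rfl⟩
    exact h _
  · intro h i
    refine Fin.cases ?_ (fun i => h _ ⟨i, rfl⟩) i
    simp

variable [Fintype F]

/-- Orbit–stabilizer: the orbit of `z` consists of frames with the Gram matrix of `z`, and each
fibre of `θ ↦ θ z` is a coset of the fixator. -/
theorem card_orthogonalGroup_le_fixator (hF : ringChar F ≠ 2) {d m : ℕ} {z : Fin m → Fin d → F}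
    (hz : LinearIndependent F z) :
    Nat.card (Matrix.orthogonalGroup (Fin d) F) ≤ (fixator (Set.range z)).ncard *
      (2 ^ m * Fintype.card F ^ ∑ j ∈ Finset.range m, (d - 1 - j)) := by
  classical
  let g : ℕ → ℕ → F := fun i j => if h : i < m ∧ j < m then z ⟨i, h.1⟩ ⬝ᵥ z ⟨j, h.2⟩ else 0
  have hmaps : ∀ θ ∈ (Finset.univ : Finset (Matrix.orthogonalGroup (Fin d) F)),
      (fun i => (θ : Matrix (Fin d) (Fin d) F) *ᵥ z i) ∈ (frameSet g d (fun _ => 0) 0 m).toFinset := by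
    intro θ _
    rw [Set.mem_toFinset]
    refine ⟨?_, fun i j => ?_, fun i hi => absurd hi (Nat.not_lt_zero _)⟩
    · exact hz.map' (Matrix.mulVecLin (θ : Matrix (Fin d) (Fin d) F))
        (LinearMap.ker_eq_bot.2 (orthogonalGroup_mulVec_injective θ))
    · rw [orthogonalGroup_dotProduct]; simp [g]
  have key := Finset.card_le_mul_card_image_of_maps_to hmaps (fixator (Set.range z)).ncard
    fun w _ => by
      rcases (Finset.univ.filter fun θ : Matrix.orthogonalGroup (Fin d) F =>
        (fun i => (θ : Matrix (Fin d) (Fin d) F) *ᵥ z i) = w).eq_empty_or_nonempty with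
        h0 | ⟨θ₀, h₀⟩
      · rw [h0]; simp
      rw [Set.ncard_eq_toFinset_card']
      refine Finset.card_le_card_of_injOn 
        (fun θ : Matrix.orthogonalGroup (Fin d) F => θ₀⁻¹ * θ) ?_ fun a _ b _ h =>
        mul_left_cancel h
      intro θ hθ
      simp only [Finset.mem_filter, Finset.mem_univ, true_and, Finset.coe_filter,
        Set.mem_ofPred_eq] at h₀ hθ
      simp only [Set.coe_toFinset]
      rintro _ ⟨i, rfl⟩
      apply orthogonalGroup_mulVec_injective θ₀
      have h1 : (θ₀ * (θ₀⁻¹ * θ) : Matrix.orthogonalGroup (Fin d) F) = θ := mul_inv_cancel_left _ _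
      have h2 := congrArg (fun M : Matrix.orthogonalGroup (Fin d) F =>
        (M : Matrix (Fin d) (Fin d) F) *ᵥ z i) h1
      simp only [Matrix.mulVec_mulVec]
      refine Eq.trans h2 ?_
      exact (congrFun hθ i).trans (congrFun h₀ i).symm
  rw [← Set.ncard_eq_toFinset_card', Finset.card_univ, ← Nat.card_eq_fintype_card] at key
  refine key.trans (Nat.mul_le_mul_left _ ?_)
  have := ncard_frameSet_le hF g (d := d) (fun _ => 0) (Nat.zero_le m)
  simpa using this

theorem card_orthogonalGroup_le_minStab (hF : ringChar F ≠ 2) (d n : ℕ) :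
    Nat.card (Matrix.orthogonalGroup (Fin d) F) ≤ minStab F d n *
      (2 ^ (min n d) * Fintype.card F ^ ∑ j ∈ Finset.range (min n d), (d - 1 - j)) := by
  obtain ⟨y, hy⟩ := exists_eq_ciInf_of_finite (f := fun y : Fin (n + 1) → Fin d → F =>
    Nat.card {θ : Matrix.orthogonalGroup (Fin d) F //
      ∀ i, (θ : Matrix (Fin d) (Fin d) F) *ᵥ (y i - y 0) = y i - y 0})
  rw [minStab, ← hy, nat_card_stabilizer_eq]
  obtain ⟨z, hz, hle⟩ := exists_linearIndependent_span_ge fun i : Fin n => y i.succ - y 0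
  refine (card_orthogonalGroup_le_fixator hF hz).trans (Nat.mul_le_mul_right _ ?_)
  refine Set.ncard_le_ncard ?_ (Set.toFinite _)
  rw [← fixator_span (Set.range z), ← fixator_span (Set.range _)]
  exact fun θ hθ v hv => hθ v (hle hv)

theorem minStab_pos (d n : ℕ) : 0 < minStab F d n := by
  obtain ⟨y, hy⟩ := exists_eq_ciInf_of_finite (f := fun y : Fin (n + 1) → Fin d → F =>
    Nat.card {θ : Matrix.orthogonalGroup (Fin d) F //
      ∀ i, (θ : Matrix (Fin d) (Fin d) F) *ᵥ (y i - y 0) = y i - y 0})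
  rw [minStab, ← hy]
  have : Nonempty {θ : Matrix.orthogonalGroup (Fin d) F //
      ∀ i, (θ : Matrix (Fin d) (Fin d) F) *ᵥ (y i - y 0) = y i - y 0} := ⟨1, by simp⟩
  exact Nat.card_pos

theorem minStab_le (hF : ringChar F ≠ 2) (d n : ℕ) :
    minStab F d n ≤ 2 ^ (d - min n d) *
      Fintype.card F ^ ∑ j ∈ Finset.Ico (min n d) d, (d - 1 - j) := by
  classical
  let z : ℕ → Fin d → F := fun i => if h : i < d then Pi.single ⟨i, h⟩ 1 else 0
  -- The test simplex is the origin with the first standard basis vectors, filled up with zeros if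
  -- `n > d`.
  let y : Fin (n + 1) → Fin d → F := Fin.cons 0 fun i => z i
  refine (ciInf_le (OrderBot.bddBelow _) y).trans ?_
  rw [nat_card_stabilizer_eq]
  let g : ℕ → ℕ → F := fun i j => if i = j then 1 else 0
  refine le_trans ?_ (ncard_frameSet_le hF g z (min_le_right n d))
  -- The columns of `θ` form an orthonormal frame, and the first `min n d` of them are fixed basis
  -- vectors. The transpose turns these columns into rows.
  refine Set.ncard_le_ncard_of_injOn
    (fun θ => (θ : Matrix (Fin d) (Fin d) F)ᵀ) ?_ ?_ (Set.toFinite _)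
  · intro θ hθ
    have h := (Matrix.mem_orthogonalGroup_iff' (Fin d) F).1 θ.2
    refine ⟨?_, fun i j => ?_, fun i hi => ?_⟩
    · have hu : IsUnit (θ : Matrix (Fin d) (Fin d) F)ᵀ :=
        IsUnit.of_mul_eq_one _ h
      exact Matrix.linearIndependent_rows_of_isUnit hu
    · have := congrFun (congrFun h i) j
      simpa [g, Matrix.mul_apply, dotProduct, Matrix.one_apply, Fin.ext_iff] using this
    · have h1 := hθ (z i) ⟨⟨i, lt_of_lt_of_le hi (min_le_left _ _)⟩, by
        simp only [y, Fin.cons_succ, Fin.cons_zero, sub_zero]⟩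
      have hz : z i = Pi.single i 1 := by simp [z]
      rw [hz] at h1 ⊢
      rw [← h1, Matrix.mulVec_single_one]
      rfl
  · intro θ _ θ' _ h
    exact Subtype.ext (Matrix.transpose_injective h)

end Stabilizers

/-! ### Counting congruence classes through Gram matrices -/

section CongruenceClasses

variable {F : Type} [Field F]

theorem sqDist_eq_dotProduct {d : ℕ} (x y : Fin d → F) : sqDist x y = (x - y) ⬝ᵥ (x - y) := by
  simp [sqDist, dotProduct, pow_two]

theorem simplexCongr_iff_gram [Fintype F] (hF : ringChar F ≠ 2) {d n : ℕ} (x y : Fin (n + 1) → Fin d → F) :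
    (simplexCongr F d n) x y ↔ ∀ i j : Fin n,
      (x i.succ - x 0) ⬝ᵥ (x j.succ - x 0) = (y i.succ - y 0) ⬝ᵥ (y j.succ - y 0) := by
  have h2 : (2 : F) ≠ 0 := Ring.two_ne_zero hF
  have polar : ∀ a b c : Fin d → F,
      2 * ((a - c) ⬝ᵥ (b - c)) = sqDist a c + sqDist b c - sqDist a b := by
    intro a b c
    simp only [sqDist_eq_dotProduct, sub_dotProduct, dotProduct_sub]
    rw [dotProduct_comm b a, dotProduct_comm c a, dotProduct_comm c b]
    ring
  have symm : ∀ a b : Fin d → F, sqDist a b = sqDist b a := fun a b => by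
    simp only [sqDist]
    exact Finset.sum_congr rfl fun _ _ => by ring
  constructor
  · intro h i j
    have h' : ∀ i j, sqDist (x i) (x j) = sqDist (y i) (y j) := h
    apply mul_left_cancel₀ h2
    rw [polar, polar, h', h', h']
  · intro h
    have h0 : ∀ i, sqDist (x i) (x 0) = sqDist (y i) (y 0) := by
      intro i
      refine Fin.cases ?_ (fun i => ?_) i
      · simp [sqDist]
      · rw [sqDist_eq_dotProduct, sqDist_eq_dotProduct, h]
    change ∀ i j, sqDist (x i) (x j) = sqDist (y i) (y j)
    intro i j
    refine Fin.cases ?_ (fun i => ?_) i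
    · rw [symm, symm (y 0), h0]
    · refine Fin.cases (h0 _) (fun j => ?_) j
      have h1 := polar (x i.succ) (x j.succ) (x 0)
      have h3 := polar (y i.succ) (y j.succ) (y 0)
      rw [h, h3, h0, h0] at h1
      linear_combination h1

/-- Expand `v i` over `v` on `I` with coefficients `b`, and `w j` over `w` on `I` with coefficients
`c`. Both products then equal the double sum of `b k * c l * (v k ⬝ᵥ v l)`. -/
theorem gram_eq_of_spanning {d n : ℕ} {v w : Fin n → Fin d → F} {I : Finset (Fin n)}
    (hv : ∀ i, v i ∈ Submodule.span F (v '' I)) (hw : ∀ i, w i ∈ Submodule.span F (w '' I))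
    (h : ∀ k ∈ I, ∀ j, v k ⬝ᵥ v j = w k ⬝ᵥ w j) (i j : Fin n) : v i ⬝ᵥ v j = w i ⬝ᵥ w j := by
  obtain ⟨b, hb⟩ := (Submodule.mem_span_image_finset_iff_exists_fun F).1 (hv i)
  obtain ⟨c, hc⟩ := (Submodule.mem_span_image_finset_iff_exists_fun F).1 (hw j)
  have h1 : v i ⬝ᵥ v j = ∑ k, b k * (w k ⬝ᵥ w j) := by
    rw [← hb, sum_dotProduct]
    exact Finset.sum_congr rfl fun k _ => by rw [smul_dotProduct, smul_eq_mul, h k k.2]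
  have h3 : ∀ k : I, w k ⬝ᵥ w j = ∑ l, c l * (v k ⬝ᵥ v l) := fun k => by
    rw [← hc, dotProduct_sum]
    exact Finset.sum_congr rfl fun l _ => by rw [dotProduct_smul, smul_eq_mul, h k k.2]
  have h4 : w i ⬝ᵥ w j = ∑ l, c l * (v i ⬝ᵥ v l) := by
    rw [← hc, dotProduct_sum]
    refine Finset.sum_congr rfl fun l _ => ?_
    rw [dotProduct_smul, smul_eq_mul, dotProduct_comm (w i), dotProduct_comm (v i), h l l.2]
  rw [h1, h4, Finset.sum_congr rfl fun k _ => by rw [h3 k, Finset.mul_sum]]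
  rw [Finset.sum_comm]
  refine Finset.sum_congr rfl fun l _ => ?_
  rw [← hb, sum_dotProduct, Finset.mul_sum]
  refine Finset.sum_congr rfl fun k _ => ?_
  rw [smul_dotProduct, smul_eq_mul]; ring

theorem exists_spanning_card_eq {d n : ℕ} (v : Fin n → Fin d → F) :
    ∃ I : Finset (Fin n), I.card = min n d ∧ ∀ i, v i ∈ Submodule.span F (v '' I) := by
  classical
  obtain ⟨κ, a, ha, hspan, hli⟩ := exists_linearIndependent' F v
  have : Fintype κ := Fintype.ofInjective a ha
  have hκ : Fintype.card κ ≤ d := by simpa using hli.fintype_card_le_finrank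
  have h1 : (Finset.univ.image a).card = Fintype.card κ := by
    rw [Finset.card_image_of_injective _ ha, Finset.card_univ]
  obtain ⟨I, haI, _, hI⟩ := Finset.exists_subsuperset_card_eq (Finset.subset_univ (Finset.univ.image a))
    (n := min n d) (le_min (by simpa using Finset.card_le_univ (Finset.univ.image a)) (h1 ▸ hκ))
    (by simp)
  refine ⟨I, hI, fun i => ?_⟩
  have h3 : v i ∈ Submodule.span F (Set.range v) := Submodule.subset_span ⟨i, rfl⟩
  rw [← hspan] at h3
  refine Submodule.span_mono ?_ h3
  rintro _ ⟨k, rfl⟩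
  exact ⟨a k, haI (Finset.mem_image_of_mem _ (Finset.mem_univ k)), rfl⟩

/-- The number of pairs of (possibly equal) indices below `n` that meet a set of `min n d`
indices. -/
def gramExponent (d n : ℕ) : ℕ := (n + 1).choose 2 - (n - min n d + 1).choose 2

variable [Fintype F]

/-- Sort the classes by a spanning index set of size `min n d`, for which there are at most `2 ^ n`
choices. Within one sort, the Gram entries meeting that set determine the class. -/
theorem numCongrClasses_le (hF : ringChar F ≠ 2) (d n : ℕ) :
    numCongrClasses F d n ≤ 2 ^ n * Fintype.card F ^ gramExponent d n := by
  classical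
  let vec : Quotient (simplexCongr F d n) → Fin n → Fin d → F :=
    fun s i => s.out i.succ - s.out 0
  choose J hJc hJ using fun s => exists_spanning_card_eq (vec s)
  have : Fintype (Quotient (simplexCongr F d n)) := Fintype.ofFinite _
  have key := Finset.card_le_mul_card_image_of_maps_to
    (f := J) (s := Finset.univ) (t := (Finset.univ : Finset (Finset (Fin n))))
    (fun _ _ => Finset.mem_univ _) (Fintype.card F ^ gramExponent d n) fun I _ => by
      rcases (Finset.univ.filter fun s => J s = I).eq_empty_or_nonempty with h0 | ⟨s₀, h₀⟩
      · rw [h0]; simp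
      have hIc : I.card = min n d := by
        rw [← (Finset.mem_filter.1 h₀).2]; exact hJc _
      let P : Finset (Sym2 (Fin n)) := (Iᶜ.sym2)ᶜ
      have hP : P.card = gramExponent d n := by
        rw [Finset.card_compl, Finset.card_sym2, Sym2.card, Finset.card_compl, hIc,
          Fintype.card_fin]
        rfl
      let gr : Quotient (simplexCongr F d n) → P → F := fun s p =>
        Sym2.lift ⟨fun i j => vec s i ⬝ᵥ vec s j, fun i j => dotProduct_comm _ _⟩ p.1
      have hc : Fintype.card (P → F) = Fintype.card F ^ gramExponent d n := by
        rw [Fintype.card_fun, Fintype.card_coe, hP]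
      rw [← hc, ← Finset.card_univ]
      refine Finset.card_le_card_of_injOn gr (fun _ _ => Finset.mem_coe.2 (Finset.mem_univ _)) ?_
      intro s hs t ht hst
      have hs' : J s = I := by simpa using hs
      have ht' : J t = I := by simpa using ht
      rw [← s.out_eq, ← t.out_eq]
      refine Quotient.sound ?_
      refine (simplexCongr_iff_gram hF _ _).2
        (gram_eq_of_spanning (I := I) (by rw [← hs']; exact hJ s) (by rw [← ht']; exact hJ t) ?_)
      intro k hk j
      have hm : s(k, j) ∈ P := by
        simp only [P, Finset.mem_compl, Finset.mk_mem_sym2_iff, not_and]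
        exact fun h => absurd hk h
      exact congrFun hst ⟨s(k, j), hm⟩
  rw [numCongrClasses, Nat.card_eq_fintype_card, ← Finset.card_univ]
  refine key.trans (le_of_eq ?_)
  rw [Finset.card_univ, Fintype.card_finset, Fintype.card_fin, mul_comm]

theorem pow_le_card_linearIndependent {d m : ℕ} (hm : m ≤ d) :
    Fintype.card F ^ (d * m) ≤ 2 ^ m *
      Nat.card {s : Fin m → Fin d → F // LinearIndependent F s} := by
  rw [card_linearIndependent (by simpa using hm), Module.finrank_fin_fun]
  rw [pow_mul, ← Finset.card_fin m, ← Finset.prod_const, ← Finset.prod_const, Finset.card_fin,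
    ← Finset.prod_mul_distrib]
  refine Finset.prod_le_prod' fun i _ => ?_
  have hi := i.2
  have hq : 2 ≤ Fintype.card F := Fintype.one_lt_card
  have h1 : Fintype.card F ^ (i : ℕ) * 2 ≤ Fintype.card F ^ d := by
    calc Fintype.card F ^ (i : ℕ) * 2 ≤ Fintype.card F ^ (i : ℕ) * Fintype.card F := by gcongr
      _ = Fintype.card F ^ ((i : ℕ) + 1) := (pow_succ _ _).symm
      _ ≤ _ := Nat.pow_le_pow_right (by omega) (by omega)
  omega

/-- Count tuples whose first `m = min n d` vectors are independent. Within a class these `m` vectors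
form a frame with fixed Gram matrix; any further vectors occur only if `m = d`, and are then
determined by their inner products with this basis. -/
theorem pow_le_numCongrClasses_mul (hF : ringChar F ≠ 2) (d n : ℕ) :
    Fintype.card F ^ (d * n) ≤ 2 ^ (min n d) * (numCongrClasses F d n *
      (2 ^ (min n d) * Fintype.card F ^ ∑ j ∈ Finset.range (min n d), (d - 1 - j))) := by
  classical
  obtain ⟨m, hm⟩ : ∃ m, m = min n d := ⟨_, rfl⟩
  obtain ⟨r, rfl⟩ : ∃ r, n = m + r := ⟨n - m, by omega⟩
  rw [← hm]
  have hmd : m ≤ d := hm ▸ min_le_right _ _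
  have hr : 0 < r → m = d := fun h => by omega
  let A := {s : Fin m → Fin d → F // LinearIndependent F s}
  have : Fintype (Quotient (simplexCongr F d (m + r))) := Fintype.ofFinite _
  have : Fintype A := Fintype.ofFinite _
  let vec : A × (Fin r → Fin d → F) → Fin (m + r) → Fin d → F := fun p => Fin.append p.1.1 p.2
  let f : A × (Fin r → Fin d → F) → Quotient (simplexCongr F d (m + r)) :=
    fun p => Quotient.mk _ (Fin.cons 0 (vec p))
  have hgram : ∀ p p', f p = f p' → ∀ i j, vec p i ⬝ᵥ vec p j = vec p' i ⬝ᵥ vec p' j := by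
    intro p p' h
    have := (simplexCongr_iff_gram hF _ _).1 (Quotient.exact h)
    simpa using this
  have key := Finset.card_le_mul_card_image_of_maps_to (f := f) (s := Finset.univ)
    (t := Finset.univ) (fun _ _ => Finset.mem_univ _)
    (2 ^ m * Fintype.card F ^ ∑ j ∈ Finset.range m, (d - 1 - j)) fun c _ => by
      rcases (Finset.univ.filter fun p => f p = c).eq_empty_or_nonempty with h0 | ⟨p₀, h₀⟩
      · rw [h0]; simp
      rw [Finset.mem_filter] at h₀
      let g : ℕ → ℕ → F := fun i j =>
        if h : i < m ∧ j < m then p₀.1.1 ⟨i, h.1⟩ ⬝ᵥ p₀.1.1 ⟨j, h.2⟩ else 0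
      have hfr := ncard_frameSet_le hF g (d := d) (fun _ => 0) (Nat.zero_le m)
      rw [Nat.sub_zero, ← Finset.range_eq_Ico, Set.ncard_eq_toFinset_card'] at hfr
      refine le_trans (Finset.card_le_card_of_injOn (fun p => p.1.1) ?_ ?_) hfr
      · intro p hp
        have hp' : f p = c := by simpa using hp
        simp only [Set.coe_toFinset]
        refine ⟨p.1.2, fun i j => ?_, fun i hi => absurd hi (Nat.not_lt_zero _)⟩
        have := hgram p p₀ (hp'.trans h₀.2.symm) (Fin.castAdd r i) (Fin.castAdd r j)
        simpa [vec, g] using this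
      · intro p hp p' hp' h
        have hpp : f p = f p' := by
          have h1 : f p = c := by simpa using hp
          have h3 : f p' = c := by simpa using hp'
          rw [h1, h3]
        have h1 : p.1 = p'.1 := Subtype.ext h
        refine Prod.ext h1 (funext fun i => ?_)
        have hmd' := hr (by have := i.2; omega)
        have hspan : Submodule.span F (Set.range p.1.1) = ⊤ := by
          apply Submodule.eq_top_of_finrank_eq
          rw [finrank_span_eq_card p.1.2]
          simp [hmd']
        rw [← sub_eq_zero]
        refine dotProduct_eq_zero _ fun w => ?_
        have hw : w ∈ Submodule.span F (Set.range p.1.1) := by rw [hspan]; trivial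
        induction hw using Submodule.span_induction with
        | mem x hx =>
          obtain ⟨k, rfl⟩ := hx
          have h3 := hgram p p' hpp (Fin.natAdd m i) (Fin.castAdd r k)
          simp only [vec, Fin.append_right, Fin.append_left] at h3
          rw [sub_dotProduct, h3, ← h1, sub_self]
        | zero => exact dotProduct_zero _
        | add x z _ _ hx hz => rw [dotProduct_add, hx, hz, add_zero]
        | smul a x _ hx => rw [dotProduct_smul, hx, smul_zero]
  have hA := pow_le_card_linearIndependent (F := F) hmd
  rw [Finset.card_univ, Fintype.card_prod, Fintype.card_fun, Fintype.card_fun, Fintype.card_fin,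
    Fintype.card_fin, ← pow_mul, Finset.card_univ] at key
  rw [numCongrClasses, Nat.card_eq_fintype_card]
  rw [Nat.card_eq_fintype_card] at hA
  calc Fintype.card F ^ (d * (m + r)) = Fintype.card F ^ (d * m) * Fintype.card F ^ (d * r) := by
        rw [mul_add, pow_add]
    _ ≤ 2 ^ m * Fintype.card A * Fintype.card F ^ (d * r) := by gcongr
    _ = 2 ^ m * (Fintype.card A * Fintype.card F ^ (d * r)) := by ring
    _ ≤ _ := by
      refine Nat.mul_le_mul_left _ (key.trans (le_of_eq (mul_comm _ _)))

end CongruenceClasses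

/-! ### Comparing the exponents of classes and stabilizers -/

section Exponents

theorem sum_range_sub_add_choose {d m : ℕ} (hm : m ≤ d) :
    ∑ j ∈ Finset.range m, (d - 1 - j) + (m + 1).choose 2 = d * m := by
  induction m with
  | zero => simp
  | succ m ih =>
    have h := ih (by omega)
    have h1 : (m + 1 + 1).choose 2 = (m + 1) + (m + 1).choose 2 := by
      rw [Nat.choose_succ_succ' (m + 1) 1, Nat.choose_one_right]
    rw [Finset.sum_range_succ, h1, mul_add, ← h]
    omega

theorem choose_two_add (d r : ℕ) :
    (d + r + 1).choose 2 = (d + 1).choose 2 + (r + 1).choose 2 + d * r := by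
  induction r with
  | zero => simp
  | succ r ih =>
    have h1 : ∀ k : ℕ, (k + 1 + 1).choose 2 = (k + 1) + (k + 1).choose 2 := fun k => by
      rw [Nat.choose_succ_succ' (k + 1) 1, Nat.choose_one_right]
    rw [← add_assoc, h1, h1, ih]
    ring

theorem gramExponent_add (d n : ℕ) :
    gramExponent d n + ∑ j ∈ Finset.range (min n d), (d - 1 - j) = d * n := by
  unfold gramExponent
  rcases le_total n d with h | h
  · rw [min_eq_left h, ← sum_range_sub_add_choose h]
    simp [add_comm]
  · obtain ⟨r, rfl⟩ := Nat.exists_eq_add_of_le h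
    rw [min_eq_right h, choose_two_add, mul_add, ← sum_range_sub_add_choose le_rfl]
    simp only [Nat.add_sub_cancel_left]
    omega

theorem sum_Ico_add_sum_range (d n : ℕ) :
    ∑ j ∈ Finset.Ico (min n d) d, (d - 1 - j) + ∑ j ∈ Finset.range (min n d), (d - 1 - j) =
      ∑ j ∈ Finset.range d, (d - 1 - j) := by
  rw [add_comm, Finset.sum_range_add_sum_Ico _ (min_le_right n d)]

theorem pow_gramExponent_le {F : Type} [Field F] [Fintype F] (hF : ringChar F ≠ 2) (d n : ℕ) :
    Fintype.card F ^ gramExponent d n ≤ 4 ^ (min n d) * numCongrClasses F d n := by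
  have h := pow_le_numCongrClasses_mul (F := F) hF d n
  rw [← gramExponent_add, pow_add] at h
  refine Nat.le_of_mul_le_mul_right (h.trans (le_of_eq ?_))
    (show 0 < Fintype.card F ^ ∑ j ∈ Finset.range (min n d), (d - 1 - j) from
      pow_pos Fintype.card_pos _)
  rw [show 4 = 2 * 2 by norm_num, mul_pow]
  ring

theorem isClassExponent_gramExponent (d n : ℕ) : IsClassExponent d n (gramExponent d n) := by
  refine ⟨((4 : ℝ) ^ (min n d))⁻¹, 2 ^ n, by positivity, by positivity, fun F _ _ hF => ⟨?_, ?_⟩⟩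
  · rw [zpow_natCast, inv_mul_le_iff₀ (by positivity)]
    exact_mod_cast pow_gramExponent_le hF d n
  · rw [zpow_natCast]
    exact_mod_cast numCongrClasses_le hF d n

theorem isClassExponent_classExponent (d n : ℕ) : IsClassExponent d n (classExponent d n) :=
  Classical.epsilon_spec (p := IsClassExponent d n) ⟨_, isClassExponent_gramExponent d n⟩

theorem exists_pow_le_minStab (d n : ℕ) : ∃ K : ℕ, ∀ (F : Type) [Field F] [Fintype F],
    ringChar F ≠ 2 → Fintype.card F ^ (∑ j ∈ Finset.Ico (min n d) d, (d - 1 - j)) ≤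
      K * minStab F d n := by
  refine ⟨(2 * d + 2) ^ (∑ j ∈ Finset.range d, (d - 1 - j) + 1) * 2 ^ min n d,
    fun F _ _ hF => ?_⟩
  have h1 := card_pow_le_card_orthogonalGroup hF d
  have h2 := card_orthogonalGroup_le_minStab hF d n
  rw [← sum_Ico_add_sum_range d n, pow_add] at h1
  rw [← sum_Ico_add_sum_range d n]
  refine Nat.le_of_mul_le_mul_right ((h1.trans (Nat.mul_le_mul_left _ h2)).trans (le_of_eq ?_))
    (show 0 < Fintype.card F ^ ∑ j ∈ Finset.range (min n d), (d - 1 - j) from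
      pow_pos Fintype.card_pos _)
  ring

/-- `Stab(n)` is of the order of magnitude `q ^ (c_d(n) - d n + d (d - 1) / 2)`. -/
theorem exists_minStab_comparable (d n : ℕ) : ∃ A B : ℝ, 0 < A ∧ 0 < B ∧
    ∀ (F : Type) [Field F] [Fintype F], ringChar F ≠ 2 →
      A * (Fintype.card F : ℝ) ^ (classExponent d n - d * n +
        (∑ j ∈ Finset.range d, (d - 1 - j) : ℕ)) ≤ (minStab F d n : ℝ) ∧
      (minStab F d n : ℝ) ≤ B * (Fintype.card F : ℝ) ^ (classExponent d n - d * n +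
        (∑ j ∈ Finset.range d, (d - 1 - j) : ℕ)) := by
  -- `classExponent` is used only through its two-sided bound, so it need not be identified with
  -- `gramExponent`: both powers are compared with the number of classes.
  obtain ⟨A, B, hA, hB, h⟩ := isClassExponent_classExponent d n
  obtain ⟨K, hK⟩ := exists_pow_le_minStab d n
  refine ⟨A / (2 ^ n * (K + 1)), 2 ^ (d - min n d) * (4 ^ min n d * B), by positivity,
    by positivity, fun F _ _ hF => ?_⟩
  obtain ⟨h1, h2⟩ := h F hF
  set q : ℝ := (Fintype.card F : ℝ) with hq
  have hq0 : 0 < q := by rw [hq]; exact_mod_cast Fintype.card_pos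
  have hS : q ^ (∑ j ∈ Finset.Ico (min n d) d, (d - 1 - j)) = q ^ gramExponent d n *
      q ^ (- (d * n : ℤ) + (∑ j ∈ Finset.range d, (d - 1 - j) : ℕ)) := by
    rw [← zpow_natCast, ← zpow_natCast, ← zpow_add₀ hq0.ne']
    congr 1
    have e1 := gramExponent_add d n
    have e2 := sum_Ico_add_sum_range d n
    zify at e1 e2
    push_cast
    linarith
  have hc : q ^ (classExponent d n - d * n + (∑ j ∈ Finset.range d, (d - 1 - j) : ℕ)) =
      q ^ classExponent d n *
        q ^ (- (d * n : ℤ) + (∑ j ∈ Finset.range d, (d - 1 - j) : ℕ)) := by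
    rw [← zpow_add₀ hq0.ne']
    congr 1
    ring
  have h3 : q ^ gramExponent d n ≤ 4 ^ (min n d) * (numCongrClasses F d n : ℝ) := by
    rw [hq]; exact_mod_cast pow_gramExponent_le hF d n
  have h4 : (numCongrClasses F d n : ℝ) ≤ 2 ^ n * q ^ gramExponent d n := by
    rw [hq]; exact_mod_cast numCongrClasses_le hF d n
  have h5 : q ^ (∑ j ∈ Finset.Ico (min n d) d, (d - 1 - j)) ≤ K * (minStab F d n : ℝ) := by
    rw [hq]; exact_mod_cast hK F hF
  have h6 : (minStab F d n : ℝ) ≤ 2 ^ (d - min n d) *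
      q ^ (∑ j ∈ Finset.Ico (min n d) d, (d - 1 - j)) := by
    rw [hq]; exact_mod_cast minStab_le hF d n
  rw [hS] at h5 h6
  rw [hc]
  set X := q ^ (- (d * n : ℤ) + (∑ j ∈ Finset.range d, (d - 1 - j) : ℕ)) with hX
  have hX0 : 0 < X := zpow_pos hq0 _
  constructor
  · rw [div_mul_eq_mul_div, div_le_iff₀ (by positivity)]
    calc A * (q ^ classExponent d n * X) = A * q ^ classExponent d n * X := by ring
      _ ≤ (2 ^ n * q ^ gramExponent d n) * X :=
        mul_le_mul_of_nonneg_right (h1.trans h4) hX0.le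
      _ = 2 ^ n * (q ^ gramExponent d n * X) := by ring
      _ ≤ 2 ^ n * (K * (minStab F d n : ℝ)) := by gcongr
      _ ≤ 2 ^ n * ((K + 1) * (minStab F d n : ℝ)) := by gcongr; linarith
      _ = _ := by ring
  · calc (minStab F d n : ℝ) ≤ 2 ^ (d - min n d) * (q ^ gramExponent d n * X) := h6
      _ ≤ 2 ^ (d - min n d) * ((4 ^ (min n d) * (B * q ^ classExponent d n)) * X) := by
        gcongr
        exact h3.trans (by gcongr)
      _ = _ := by ring

end Exponents

/-! ### Acyclicity, parents and products over subtrees -/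

namespace RootedSimplexTree

section TreeStructure

variable {ι V : Type*} [DecidableEq V]

/-- The bipartite incidence graph between simplices and vertices. -/
def incidenceGraph (T : RootedSimplexTree ι V) : SimpleGraph (ι ⊕ V) where
  Adj x y := (∃ i v, x = Sum.inl i ∧ y = Sum.inr v ∧ v ∈ T.simplex i) ∨
    (∃ i v, x = Sum.inr v ∧ y = Sum.inl i ∧ v ∈ T.simplex i)
  symm := ⟨fun x y h => by
    rcases h with ⟨i, v, h1, h2, h3⟩ | ⟨i, v, h1, h2, h3⟩
    · exact Or.inr ⟨i, v, h2, h1, h3⟩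
    · exact Or.inl ⟨i, v, h2, h1, h3⟩⟩
  loopless := ⟨fun x h => by
    rcases h with ⟨i, v, h1, h2, -⟩ | ⟨i, v, h1, h2, -⟩ <;> rw [h1] at h2 <;> cases h2⟩

theorem incidenceGraph_adj_inl (T : RootedSimplexTree ι V) {i : ι} {y : ι ⊕ V}
    (h : T.incidenceGraph.Adj (Sum.inl i) y) : ∃ v, y = Sum.inr v ∧ v ∈ T.simplex i := by
  rcases h with ⟨j, v, h1, h2, h3⟩ | ⟨j, v, h1, -, -⟩
  · cases h1; exact ⟨v, h2, h3⟩
  · cases h1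

theorem incidenceGraph_adj_inr (T : RootedSimplexTree ι V) {v : V} {y : ι ⊕ V}
    (h : T.incidenceGraph.Adj (Sum.inr v) y) : ∃ i, y = Sum.inl i ∧ v ∈ T.simplex i := by
  rcases h with ⟨j, v, h1, -, -⟩ | ⟨j, v, h1, h2, h3⟩
  · cases h1
  · cases h1; exact ⟨j, h2, h3⟩

/-- A cycle alternates between simplices at even positions and vertices at odd ones, hence is a
closed loop of `n` simplices. `no_loop` forbids `n ≥ 3`, and `n = 2` would give two simplices
sharing two vertices. -/
theorem incidenceGraph_not_isCycle_inl (T : RootedSimplexTree ι V) {i₀ : ι}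
    (c : T.incidenceGraph.Walk (Sum.inl i₀) (Sum.inl i₀)) : ¬ c.IsCycle := by
  intro hc
  have hodd : ∀ k, (∃ i, c.getVert (2 * k) = Sum.inl i) → 2 * k < c.length →
      ∃ v, c.getVert (2 * k + 1) = Sum.inr v := by
    rintro k ⟨i, hi⟩ hk
    have h := c.adj_getVert_succ hk
    rw [hi] at h
    obtain ⟨v, hv, -⟩ := T.incidenceGraph_adj_inl h
    exact ⟨v, hv⟩
  have heven : ∀ k, 2 * k ≤ c.length → ∃ i, c.getVert (2 * k) = Sum.inl i := by
    intro k
    induction k with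
    | zero => intro _; exact ⟨i₀, c.getVert_zero⟩
    | succ k ih =>
      intro hk
      obtain ⟨v, hv⟩ := hodd k (ih (by omega)) (by omega)
      have h := c.adj_getVert_succ (i := 2 * k + 1) (by omega)
      rw [hv] at h
      obtain ⟨i, hi, -⟩ := T.incidenceGraph_adj_inr h
      exact ⟨i, hi⟩
  obtain ⟨n, hn⟩ : ∃ n, c.length = 2 * n := by
    rcases Nat.even_or_odd' c.length with ⟨n, hn | hn⟩
    · exact ⟨n, hn⟩
    · obtain ⟨v, hv⟩ := hodd n (heven n (by omega)) (by omega)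
      rw [← hn, c.getVert_length] at hv
      cases hv
  have h3 := hc.three_le_length
  have hn0 : NeZero n := ⟨by omega⟩
  have hn1 : Fact (1 < n) := ⟨by omega⟩
  have hlt : ∀ j : ZMod n, j.val < n := fun j => ZMod.val_lt j
  choose I hI using fun j : ZMod n => heven j.val (by have := hlt j; omega)
  choose W hW using fun j : ZMod n => hodd j.val ⟨I j, hI j⟩ (by have := hlt j; omega)
  have hIinj : Function.Injective I := by
    intro j k h
    have h1 : c.getVert (2 * j.val) = c.getVert (2 * k.val) := by rw [hI, hI, h]
    have h2 := hc.getVert_injOn' (by have := hlt j; simp; omega) (by have := hlt k; simp; omega) h1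
    exact ZMod.val_injective n (by omega)
  have hWinj : Function.Injective W := by
    intro j k h
    have h1 : c.getVert (2 * j.val + 1) = c.getVert (2 * k.val + 1) := by rw [hW, hW, h]
    have h2 := hc.getVert_injOn' (by have := hlt j; simp; omega) (by have := hlt k; simp; omega) h1
    exact ZMod.val_injective n (by omega)
  have hsucc : ∀ j : ZMod n, c.getVert (2 * j.val + 1 + 1) = Sum.inl (I (j + 1)) := by
    intro j
    rw [← hI, ZMod.val_add, ZMod.val_one]
    rcases lt_or_ge (j.val + 1) n with h | h
    · rw [Nat.mod_eq_of_lt h, mul_add]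
    · have hj : j.val + 1 = n := by have := hlt j; omega
      rw [hj, Nat.mod_self, mul_zero, c.getVert_zero, show 2 * j.val + 1 + 1 = c.length by omega,
        c.getVert_length]
  have hmem : ∀ j, W j ∈ T.simplex (I j) ∩ T.simplex (I (j + 1)) := by
    intro j
    have hj := hlt j
    have h1 := c.adj_getVert_succ (i := 2 * j.val) (by omega)
    have h2 := c.adj_getVert_succ (i := 2 * j.val + 1) (by omega)
    rw [hI, hW] at h1
    rw [hW, hsucc] at h2
    obtain ⟨v, hv, hv'⟩ := T.incidenceGraph_adj_inl h1
    obtain ⟨i, hi, hi'⟩ := T.incidenceGraph_adj_inr h2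
    cases hv
    cases hi
    exact Finset.mem_inter.2 ⟨hv', hi'⟩
  rcases Nat.lt_or_ge n 3 with h | h
  · obtain rfl : n = 2 := by omega
    have h0 := hmem 0
    have h1 := hmem 1
    rw [zero_add] at h0
    rw [show (1 + 1 : ZMod 2) = 0 from rfl, Finset.inter_comm] at h1
    have hne : I 0 ≠ I 1 := fun e => zero_ne_one (hIinj e)
    exact zero_ne_one (hWinj (Finset.card_le_one.1 (T.card_inter_le_one _ _ hne) _ h0 _ h1))
  · exact T.no_loop n h I W hIinj hWinj hmem

theorem incidenceGraph_isAcyclic (T : RootedSimplexTree ι V) : T.incidenceGraph.IsAcyclic := by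
  classical
  rintro (i | v) c hc
  · exact T.incidenceGraph_not_isCycle_inl c hc
  · have h3 := hc.three_le_length
    have h := c.adj_getVert_succ (i := 0) (by omega)
    rw [c.getVert_zero] at h
    obtain ⟨i, hi, -⟩ := T.incidenceGraph_adj_inr h
    have hs : Sum.inl i ∈ c.support := by
      rw [← hi]; exact c.getVert_mem_support _
    exact T.incidenceGraph_not_isCycle_inl _ (hc.rotate hs)

theorem adjGraph_reachable (T : RootedSimplexTree ι V) (i j : ι) : T.adjGraph.Reachable i j := by
  induction T.connected i j with
  | refl => exact SimpleGraph.Reachable.refl _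
  | @tail a b _ hab ih =>
    by_cases h : a = b
    · exact h ▸ ih
    · exact ih.trans (SimpleGraph.Adj.reachable ⟨h, hab⟩)

theorem depth_eq_zero_iff (T : RootedSimplexTree ι V) {i : ι} : T.depth i = 0 ↔ i = T.root := by
  rw [depth, (T.adjGraph_reachable _ _).dist_eq_zero_iff, eq_comm]

theorem depth_le_succ_of_mem (T : RootedSimplexTree ι V) {i j : ι} {v : V} (hi : v ∈ T.simplex i)
    (hj : v ∈ T.simplex j) : T.depth j ≤ T.depth i + 1 := by
  by_cases h : i = j
  · subst h; omega
  · obtain ⟨p, hp⟩ := (T.adjGraph_reachable T.root i).exists_walk_length_eq_dist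
    have hadj : T.adjGraph.Adj i j := ⟨h, v, Finset.mem_inter.2 ⟨hi, hj⟩⟩
    have := SimpleGraph.dist_le (p.concat hadj)
    rw [SimpleGraph.Walk.length_concat, hp] at this
    exact this

theorem exists_parent (T : RootedSimplexTree ι V) {j : ι} (hj : j ≠ T.root) :
    ∃ i v, v ∈ T.simplex i ∧ v ∈ T.simplex j ∧ T.depth i < T.depth j := by
  obtain ⟨p, hp⟩ := (T.adjGraph_reachable j T.root).exists_walk_length_eq_dist
  have hnil : ¬ p.Nil := fun h => hj h.eq
  obtain ⟨-, v, hv⟩ := p.adj_snd hnil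
  rw [Finset.mem_inter] at hv
  refine ⟨p.snd, v, hv.2, hv.1, ?_⟩
  rw [depth, depth, SimpleGraph.dist_comm, SimpleGraph.dist_comm (u := T.root), ← hp,
    ← SimpleGraph.Walk.length_tail_add_one hnil]
  exact Nat.lt_succ_of_le (SimpleGraph.dist_le _)

/-- The walk descends through successive parents. The depth bounds on its support ensure that it can
be prolonged to a child of `i` without repetition. -/
theorem exists_incidence_walk (T : RootedSimplexTree ι V) (i : ι) :
    ∃ w : T.incidenceGraph.Walk (Sum.inl T.root) (Sum.inl i),
      (∀ j, Sum.inl j ∈ w.support → T.depth j ≤ T.depth i) ∧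
      ∀ v, Sum.inr v ∈ w.support → ∃ j, v ∈ T.simplex j ∧ T.depth j < T.depth i := by
  induction hn : T.depth i using Nat.strong_induction_on generalizing i with
  | _ n ih =>
    by_cases hi : i = T.root
    · subst hi
      refine ⟨SimpleGraph.Walk.nil, fun j hj => ?_, fun v hv => ?_⟩
      · simp only [SimpleGraph.Walk.support_nil, List.mem_singleton, Sum.inl.injEq] at hj
        rw [hj, hn]
      · simp at hv
    · obtain ⟨k, v, hvk, hvi, hk⟩ := T.exists_parent hi
      obtain ⟨w, hw1, hw2⟩ := ih _ (hn ▸ hk) k rfl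
      have h1 : T.incidenceGraph.Adj (Sum.inl k) (Sum.inr v) := Or.inl ⟨k, v, rfl, rfl, hvk⟩
      have h2 : T.incidenceGraph.Adj (Sum.inr v) (Sum.inl i) := Or.inr ⟨i, v, rfl, rfl, hvi⟩
      refine ⟨(w.concat h1).concat h2, fun j hj => ?_, fun u hu => ?_⟩
      · simp only [SimpleGraph.Walk.support_concat, List.mem_append, List.mem_singleton,
          Sum.inl.injEq, reduceCtorEq, or_false] at hj
        rcases hj with hj | rfl
        · have := hw1 j hj; omega
        · omega
      · simp only [SimpleGraph.Walk.support_concat, List.mem_append, List.mem_singleton,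
          Sum.inr.injEq, reduceCtorEq, or_false] at hu
        rcases hu with hu | rfl
        · obtain ⟨j, hj, hlt⟩ := hw2 u hu
          exact ⟨j, hj, by omega⟩
        · exact ⟨k, hvk, by omega⟩

/-- Two parents would give two paths from the root to `j` in an acyclic graph; these coincide, and
so do their last steps. -/
theorem parent_unique (T : RootedSimplexTree ι V) {i i' j : ι} {v v' : V}
    (hi : v ∈ T.simplex i) (hj : v ∈ T.simplex j) (hlt : T.depth i < T.depth j)
    (hi' : v' ∈ T.simplex i') (hj' : v' ∈ T.simplex j) (hlt' : T.depth i' < T.depth j) :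
    i = i' := by
  classical
  have key : ∀ {i : ι} {v : V}, v ∈ T.simplex i → v ∈ T.simplex j → T.depth i < T.depth j →
      ∃ (w : T.incidenceGraph.Walk (Sum.inl T.root) (Sum.inl i))
        (h1 : T.incidenceGraph.Adj (Sum.inl i) (Sum.inr v))
        (h2 : T.incidenceGraph.Adj (Sum.inr v) (Sum.inl j)), ((w.concat h1).concat h2).IsPath := by
    intro i v hi hj hlt
    obtain ⟨w, hw1, hw2⟩ := T.exists_incidence_walk i
    have h1 : T.incidenceGraph.Adj (Sum.inl i) (Sum.inr v) := Or.inl ⟨i, v, rfl, rfl, hi⟩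
    have h2 : T.incidenceGraph.Adj (Sum.inr v) (Sum.inl j) := Or.inr ⟨j, v, rfl, rfl, hj⟩
    refine ⟨w.bypass, h1, h2, ?_⟩
    refine SimpleGraph.Walk.IsPath.concat (SimpleGraph.Walk.IsPath.concat w.bypass_isPath
      (fun h => ?_) _) (fun h => ?_) _
    -- If `v` already lay on the walk, a simplex shallower than `i` would contain it, forcing `j` to
    -- be no deeper than `i`.
    · obtain ⟨k, hk, hkl⟩ := hw2 v (w.support_bypass_subset_support h)
      have := T.depth_le_succ_of_mem hk hj
      omega
    · rw [SimpleGraph.Walk.support_concat, List.mem_append, List.mem_singleton] at h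
      rcases h with h | h
      · have := hw1 j (w.support_bypass_subset_support h)
        omega
      · cases h
  obtain ⟨w, h1, h2, hp⟩ := key hi hj hlt
  obtain ⟨w', h1', h2', hp'⟩ := key hi' hj' hlt'
  have heq := congrArg Subtype.val
    ((SimpleGraph.isAcyclic_iff_subsingleton_path.1 T.incidenceGraph_isAcyclic _ _).elim
      (⟨_, hp⟩ : T.incidenceGraph.Path _ _) ⟨_, hp'⟩)
  obtain ⟨hv, hw⟩ := SimpleGraph.Walk.concat_inj heq
  cases hv
  obtain ⟨hv, -⟩ := SimpleGraph.Walk.concat_inj hw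
  cases hv
  rfl

variable [Fintype ι]

/-- The simplices meeting `i` and lying deeper. -/
noncomputable def children (T : RootedSimplexTree ι V) (i : ι) : Finset ι :=
  Finset.univ.filter fun j => (T.simplex i ∩ T.simplex j).Nonempty ∧ T.depth i < T.depth j

theorem mem_branchRoots (T : RootedSimplexTree ι V) {i j : ι} {v : V} :
    j ∈ T.branchRoots i v ↔ v ∈ T.simplex j ∧ T.depth i < T.depth j := by
  simp [branchRoots]

theorem mem_children (T : RootedSimplexTree ι V) {i j : ι} :
    j ∈ T.children i ↔ (T.simplex i ∩ T.simplex j).Nonempty ∧ T.depth i < T.depth j := by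
  simp [children]

/-- A simplex at `v` deeper than `j` would have both `i` and `j` as parents. Hence omitting the
designated vertex from `branchSum` omits no branch. -/
theorem branchRoots_eq_empty_of_mem (T : RootedSimplexTree ι V) {i j : ι} {v : V}
    (hi : v ∈ T.simplex i) (hj : j ∈ T.branchRoots i v) : T.branchRoots j v = ∅ := by
  rw [Finset.eq_empty_iff_forall_notMem]
  intro k hk
  rw [mem_branchRoots] at hj hk
  have := T.parent_unique hi hk.1 (hj.2.trans hk.2) hj.1 hk.1 hk.2
  subst this
  exact lt_irrefl _ hj.2

/-- Each child meets `i` in exactly one vertex, so it is counted once. -/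
theorem prod_branchRoots (T : RootedSimplexTree ι V) (i : ι) (f : ι → ℝ) :
    ∏ v ∈ T.simplex i, ∏ j ∈ T.branchRoots i v, f j = ∏ j ∈ T.children i, f j := by
  classical
  rw [← Finset.prod_biUnion]
  · congr 1
    ext j
    simp only [Finset.mem_biUnion, mem_branchRoots, mem_children, Finset.Nonempty,
      Finset.mem_inter]
    exact ⟨fun ⟨v, h1, h2, h3⟩ => ⟨⟨v, h1, h2⟩, h3⟩, fun ⟨⟨v, h1, h2⟩, h3⟩ => ⟨v, h1, h2, h3⟩⟩
  · intro v hv v' hv' hne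
    rw [Function.onFun, Finset.disjoint_left]
    intro j hj hj'
    rw [mem_branchRoots] at hj hj'
    have hij : i ≠ j := fun e => by rw [e] at hj; exact lt_irrefl _ hj.2
    exact hne (Finset.card_le_one.1 (T.card_inter_le_one i j hij) _
      (Finset.mem_inter.2 ⟨hv, hj.1⟩) _ (Finset.mem_inter.2 ⟨hv', hj'.1⟩))

/-- The product of a weight over the subtree hanging below a simplex. -/
noncomputable def subtreeProd (T : RootedSimplexTree ι V) (C : ι → ℝ) (i : ι) : ℝ :=
  C i * ∏ j ∈ (T.children i).attach, T.subtreeProd C j.1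
termination_by (Finset.univ.filter fun j => T.depth i < T.depth j).card
decreasing_by
  have hj : T.depth i < T.depth j.1 := (T.mem_children.1 j.2).2
  refine Finset.card_lt_card ⟨fun k hk => ?_, fun hsub => ?_⟩
  · simp only [Finset.mem_filter, Finset.mem_univ, true_and] at hk ⊢
    exact hj.trans hk
  · have h := hsub (Finset.mem_filter.2 ⟨Finset.mem_univ j.1, hj⟩)
    simp at h

theorem subtreeProd_eq (T : RootedSimplexTree ι V) (C : ι → ℝ) (i : ι) :
    T.subtreeProd C i = C i * ∏ j ∈ T.children i, T.subtreeProd C j := by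
  rw [subtreeProd, Finset.prod_attach (T.children i) fun j => T.subtreeProd C j]

theorem descending_induction (T : RootedSimplexTree ι V) {P : ι → Prop}
    (h : ∀ i, (∀ j, T.depth i < T.depth j → P j) → P i) (i : ι) : P i := by
  have key : ∀ n i, Finset.univ.sup T.depth - T.depth i = n → P i := by
    intro n
    induction n using Nat.strong_induction_on with
    | _ n ih =>
      intro i hi
      refine h i fun j hj => ih _ ?_ j rfl
      have : T.depth j ≤ Finset.univ.sup T.depth := Finset.le_sup (Finset.mem_univ j)
      omega
  exact key _ i rfl

theorem subtreeProd_pos (T : RootedSimplexTree ι V) {C : ι → ℝ} (hC : ∀ i, 0 < C i) (i : ι) :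
    0 < T.subtreeProd C i := by
  refine T.descending_induction (P := fun i => 0 < T.subtreeProd C i) (fun i ih => ?_) i
  rw [subtreeProd_eq]
  exact mul_pos (hC i) (Finset.prod_pos fun j hj => ih j (T.mem_children.1 hj).2)

/-- Every simplex hangs exactly once below the root. -/
theorem subtreeProd_root (T : RootedSimplexTree ι V) {C : ι → ℝ} (hC : ∀ i, 0 < C i) :
    T.subtreeProd C T.root = ∏ i, C i := by
  classical
  have h1 : ∏ i, T.subtreeProd C i =
      (∏ i, C i) * ∏ j ∈ Finset.univ.erase T.root, T.subtreeProd C j := by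
    rw [Finset.prod_congr rfl fun i _ => T.subtreeProd_eq C i, Finset.prod_mul_distrib,
      ← Finset.prod_biUnion]
    · congr 2
      ext j
      simp only [Finset.mem_biUnion, Finset.mem_univ, true_and, Finset.mem_erase, and_true,
        mem_children]
      constructor
      · rintro ⟨i, -, hi⟩ rfl
        rw [T.depth_eq_zero_iff.2 rfl] at hi
        exact Nat.not_lt_zero _ hi
      · intro hj
        obtain ⟨i, v, h1, h2, h3⟩ := T.exists_parent hj
        exact ⟨i, ⟨v, Finset.mem_inter.2 ⟨h1, h2⟩⟩, h3⟩
    · intro i _ i' _ hne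
      rw [Function.onFun, Finset.disjoint_left]
      intro j hj hj'
      rw [mem_children] at hj hj'
      obtain ⟨⟨v, hv⟩, hlt⟩ := hj
      obtain ⟨⟨v', hv'⟩, hlt'⟩ := hj'
      rw [Finset.mem_inter] at hv hv'
      exact hne (T.parent_unique hv.1 hv.2 hlt hv'.1 hv'.2 hlt')
  rw [← Finset.mul_prod_erase _ _ (Finset.mem_univ T.root)] at h1
  exact mul_right_cancel₀ (Finset.prod_pos fun j _ => T.subtreeProd_pos hC j).ne' h1

end TreeStructure

end RootedSimplexTree

/-! ### Hölder's inequality with weights summing to one -/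

section Hoelder

theorem sum_rpow_mul_rpow_le {α : Type*} (s : Finset α) {a b : α → ℝ} {r t : ℝ}
    (hr : 0 < r) (ht : 0 < t) (hrt : r + t = 1) (ha : ∀ i ∈ s, 0 ≤ a i) (hb : ∀ i ∈ s, 0 ≤ b i) :
    ∑ i ∈ s, a i ^ r * b i ^ t ≤ (∑ i ∈ s, a i) ^ r * (∑ i ∈ s, b i) ^ t := by
  have hpq : (1 / r).HolderConjugate (1 / t) := by
    rw [Real.holderConjugate_iff]
    refine ⟨?_, by simpa using hrt⟩
    rw [lt_div_iff₀ hr]; linarith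
  have h := Real.inner_le_Lp_mul_Lq_of_nonneg s hpq (fun i hi => Real.rpow_nonneg (ha i hi) r)
    (fun i hi => Real.rpow_nonneg (hb i hi) t)
  simp only [one_div_one_div] at h
  refine h.trans (le_of_eq ?_)
  congr 2
  · refine Finset.sum_congr rfl fun i hi => ?_
    rw [← Real.rpow_mul (ha i hi), mul_one_div_cancel hr.ne', Real.rpow_one]
  · refine Finset.sum_congr rfl fun i hi => ?_
    rw [← Real.rpow_mul (hb i hi), mul_one_div_cancel ht.ne', Real.rpow_one]

theorem sum_le_of_le_rpow {α : Type*} (s : Finset α) {f a b : α → ℝ} {κ r t : ℝ}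
    (hr : 0 < r) (ht : 0 < t) (hrt : r + t = 1) (hκ : 0 ≤ κ) (ha : ∀ i ∈ s, 0 ≤ a i)
    (hb : ∀ i ∈ s, 0 ≤ b i) (h : ∀ i ∈ s, f i ≤ κ * (a i ^ r * b i ^ t)) :
    ∑ i ∈ s, f i ≤ κ * ((∑ i ∈ s, a i) ^ r * (∑ i ∈ s, b i) ^ t) := by
  refine (Finset.sum_le_sum h).trans ?_
  rw [← Finset.mul_sum]
  exact mul_le_mul_of_nonneg_left (sum_rpow_mul_rpow_le s hr ht hrt ha hb) hκ

theorem prod_le_of_le_rpow {α : Type*} (s : Finset α) {f a b κ : α → ℝ} {r t : ℝ}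
    (hf : ∀ i ∈ s, 0 ≤ f i) (ha : ∀ i ∈ s, 0 ≤ a i) (hb : ∀ i ∈ s, 0 ≤ b i)
    (h : ∀ i ∈ s, f i ≤ κ i * (a i ^ r * b i ^ t)) :
    ∏ i ∈ s, f i ≤ (∏ i ∈ s, κ i) * ((∏ i ∈ s, a i) ^ r * (∏ i ∈ s, b i) ^ t) := by
  refine (Finset.prod_le_prod hf h).trans (le_of_eq ?_)
  rw [Finset.prod_mul_distrib, Finset.prod_mul_distrib, Real.finsetProd_rpow _ _ ha,
    Real.finsetProd_rpow _ _ hb]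

/-- The case `x = 0` is needed, as there may be no pairs with a given displacement; it is covered
because all exponents are nonnegative. -/
theorem pow_eq_rpow_mul_rpow {x r t : ℝ} (hx : 0 ≤ x) (hr : 0 < r) (ht : 0 < t) {n a b : ℕ}
    (h : (n : ℝ) = r * a + t * b) : x ^ n = (x ^ a) ^ r * (x ^ b) ^ t := by
  rw [← Real.rpow_natCast, ← Real.rpow_natCast, ← Real.rpow_natCast, ← Real.rpow_mul hx,
    ← Real.rpow_mul hx, h, mul_comm r, mul_comm t,
    Real.rpow_add_of_nonneg hx (by positivity) (by positivity)]

end Hoelder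

/-! ### Interpolation of the sums over the tree -/

namespace RootedSimplexTree

section Interpolation

variable {ι V : Type*} [Fintype ι] [DecidableEq V]

/-- `T'` has the same root and the same branches as `T`, and its simplices agree with those of
`T` outside a set `Z` of vertices at which no branch is attached. -/
structure SharesBranches (T T' : RootedSimplexTree ι V) (Z : Finset V) : Prop where
  root_eq : T'.root = T.root
  branchRoots_eq : ∀ i, ∀ v ∉ Z, T'.branchRoots i v = T.branchRoots i v
  branchRoots_empty : ∀ i, ∀ v ∈ Z, v ∈ T'.simplex i → T'.branchRoots i v = ∅
  sdiff_eq : ∀ i, T'.simplex i \ Z = T.simplex i \ Z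

variable {F : Type} [Field F] [Fintype F] {d : ℕ}

/-- The product over the vertices of a simplex outside `e` of the sums over the branches. -/
noncomputable def vertexProd (T : RootedSimplexTree ι V) (E : Finset (Fin d → F)) (i : ι)
    (e : Finset V) (θ : Matrix (Fin d) (Fin d) F) (w : Fin d → F) : ℝ :=
  ∏ v ∈ T.simplex i \ e, ∑ y ∈ motionPairs E θ w,
    ∏ j ∈ T.branchRoots i v, T.branchSum E j v y.1 y.2

theorem branchSum_eq_vertexProd (T : RootedSimplexTree ι V) (E : Finset (Fin d → F))
    (i : ι) (v₀ : V) (u u' : Fin d → F) :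
    T.branchSum E i v₀ u u' = (minStab F d (T.dim i) : ℝ)⁻¹ *
      ∑ θ : Matrix.orthogonalGroup (Fin d) F,
        T.vertexProd E i {v₀} θ (u - (θ : Matrix (Fin d) (Fin d) F) *ᵥ u') := by
  rw [branchSum_eq]
  simp only [vertexProd, Finset.sdiff_singleton_eq_erase]

theorem rootSum_eq_vertexProd (T : RootedSimplexTree ι V) (E : Finset (Fin d → F)) :
    T.rootSum E = (minStab F d (T.dim T.root) : ℝ)⁻¹ *
      ∑ w : Fin d → F, ∑ θ : Matrix.orthogonalGroup (Fin d) F,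
        T.vertexProd E T.root ∅ θ w := by
  simp only [rootSum, vertexProd, Finset.sdiff_empty]

theorem branchSum_nonneg (T : RootedSimplexTree ι V) (E : Finset (Fin d → F)) (i : ι) :
    ∀ v₀ u u', 0 ≤ T.branchSum E i v₀ u u' := by
  refine T.descending_induction (P := fun i => ∀ v₀ u u', 0 ≤ T.branchSum E i v₀ u u')
    (fun i ih => ?_) i
  intro v₀ u u'
  rw [branchSum_eq]
  refine mul_nonneg (by positivity) (Finset.sum_nonneg fun θ _ => Finset.prod_nonneg fun v _ =>
    Finset.sum_nonneg fun y _ => Finset.prod_nonneg fun j hj => ?_)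
  exact ih j (T.mem_branchRoots.1 hj).2 _ _ _

theorem vertexProd_nonneg (T : RootedSimplexTree ι V) (E : Finset (Fin d → F)) (i : ι)
    (e : Finset V) (θ : Matrix (Fin d) (Fin d) F) (w : Fin d → F) :
    0 ≤ T.vertexProd E i e θ w :=
  Finset.prod_nonneg fun _ _ => Finset.sum_nonneg fun _ _ => Finset.prod_nonneg fun _ _ =>
    T.branchSum_nonneg E _ _ _ _

theorem rootSum_nonneg (T : RootedSimplexTree ι V) (E : Finset (Fin d → F)) :
    0 ≤ T.rootSum E := by
  rw [rootSum_eq_vertexProd]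
  exact mul_nonneg (by positivity) (Finset.sum_nonneg fun _ _ => Finset.sum_nonneg fun _ _ =>
    T.vertexProd_nonneg E _ _ _ _)

/-- A vertex in `Z` has an empty product over branches, so its factor is just the number of motion
pairs. The remaining factors run over index sets depending on `T` alone, which makes the trees
comparable term by term. -/
theorem SharesBranches.vertexProd_eq {T T' : RootedSimplexTree ι V} {Z : Finset V}
    (h : T.SharesBranches T' Z) (E : Finset (Fin d → F)) (i : ι) {e : Finset V}
    (he : Disjoint e Z) (θ : Matrix (Fin d) (Fin d) F) (w : Fin d → F) :
    T'.vertexProd E i e θ w = ((motionPairs E θ w).card : ℝ) ^ (T'.simplex i ∩ Z).card *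
      ∏ v ∈ (T.simplex i \ Z) \ e, ∑ y ∈ motionPairs E θ w,
        ∏ j ∈ T.branchRoots i v, T'.branchSum E j v y.1 y.2 := by
  have hsplit : T'.simplex i \ e = (T'.simplex i ∩ Z) ∪ ((T.simplex i \ Z) \ e) := by
    rw [← h.sdiff_eq]
    ext v
    simp only [Finset.mem_sdiff, Finset.mem_union, Finset.mem_inter]
    have : v ∈ e → v ∉ Z := fun h1 h2 => Finset.disjoint_left.1 he h1 h2
    tauto
  have hdisj : Disjoint (T'.simplex i ∩ Z) ((T.simplex i \ Z) \ e) := by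
    rw [Finset.disjoint_left]
    intro v hv hv'
    simp only [Finset.mem_sdiff, Finset.mem_inter] at hv hv'
    exact hv'.1.2 hv.2
  rw [vertexProd, hsplit, Finset.prod_union hdisj]
  congr 1
  · rw [← Finset.prod_const]
    refine Finset.prod_congr rfl fun v hv => ?_
    rw [Finset.mem_inter] at hv
    rw [h.branchRoots_empty i v hv.2 hv.1]
    simp
  · refine Finset.prod_congr rfl fun v hv => ?_
    rw [h.branchRoots_eq i v (Finset.mem_sdiff.1 (Finset.mem_sdiff.1 hv).1).2]

/-- The factor contributed by the stabilizers of a simplex to the interpolation inequality. -/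
noncomputable def stabFactor (F : Type) [Field F] [Fintype F] (d : ℕ) (r t : ℝ) (n a b : ℕ) : ℝ :=
  (minStab F d n : ℝ)⁻¹ * ((minStab F d a : ℝ) ^ r * (minStab F d b : ℝ) ^ t)

theorem stabFactor_pos (d : ℕ) (r t : ℝ) (n a b : ℕ) : 0 < stabFactor F d r t n a b := by
  have h := fun n => minStab_pos (F := F) d n
  have h1 : ∀ n, (0 : ℝ) < minStab F d n := fun n => by exact_mod_cast h n
  exact mul_pos (inv_pos.2 (h1 n)) (mul_pos (Real.rpow_pos_of_pos (h1 a) _)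
    (Real.rpow_pos_of_pos (h1 b) _))

theorem inv_minStab_mul_le {r t κ x y z : ℝ} (hy : 0 ≤ y) (hz : 0 ≤ z) {n a b : ℕ}
    (h : x ≤ κ * (y ^ r * z ^ t)) :
    (minStab F d n : ℝ)⁻¹ * x ≤ (stabFactor F d r t n a b * κ) *
      (((minStab F d a : ℝ)⁻¹ * y) ^ r * ((minStab F d b : ℝ)⁻¹ * z) ^ t) := by
  have h1 : ∀ n, (0 : ℝ) < minStab F d n := fun n => by exact_mod_cast minStab_pos d n
  have ha := h1 a
  have hb := h1 b
  refine (mul_le_mul_of_nonneg_left h (inv_pos.2 (h1 n)).le).trans (le_of_eq ?_)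
  rw [stabFactor, Real.mul_rpow (inv_pos.2 ha).le hy, Real.mul_rpow (inv_pos.2 hb).le hz,
    Real.inv_rpow ha.le, Real.inv_rpow hb.le]
  have ha' := (Real.rpow_pos_of_pos ha r).ne'
  have hb' := (Real.rpow_pos_of_pos hb t).ne'
  field_simp

section ThreeTrees

variable {T T₁ T₂ : RootedSimplexTree ι V} {Z : Finset V} {r t : ℝ}

theorem vertexProd_le (h : T.SharesBranches T Z) (h₁ : T.SharesBranches T₁ Z)
    (h₂ : T.SharesBranches T₂ Z) (hr : 0 < r) (ht : 0 < t) (hrt : r + t = 1)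
    (hcard : ∀ i, ((T.simplex i ∩ Z).card : ℝ) =
      r * (T₁.simplex i ∩ Z).card + t * (T₂.simplex i ∩ Z).card)
    (E : Finset (Fin d → F)) (i : ι) {e : Finset V} (he : Disjoint e Z)
    (hbe : ∀ v ∈ e, T.branchRoots i v = ∅) {K : ι → ℝ} (hK : ∀ j, 0 < K j)
    (ih : ∀ v ∈ T.simplex i, v ∉ Z → ∀ j ∈ T.branchRoots i v, ∀ x x' : Fin d → F,
      T.branchSum E j v x x' ≤ K j * (T₁.branchSum E j v x x' ^ r * T₂.branchSum E j v x x' ^ t))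
    (θ : Matrix (Fin d) (Fin d) F) (w : Fin d → F) :
    T.vertexProd E i e θ w ≤ (∏ j ∈ T.children i, K j) *
      (T₁.vertexProd E i e θ w ^ r * T₂.vertexProd E i e θ w ^ t) := by
  -- The vertices left out, in `Z` or in `e`, carry no branches, so the constants of all children
  -- still appear.
  have hκ : ∏ j ∈ T.children i, K j =
      ∏ v ∈ (T.simplex i \ Z) \ e, ∏ j ∈ T.branchRoots i v, K j := by
    rw [← prod_branchRoots]
    symm
    refine Finset.prod_subset (Finset.sdiff_subset.trans Finset.sdiff_subset) fun v hv hv' => ?_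
    simp only [Finset.mem_sdiff, not_and, not_not] at hv'
    by_cases hvZ : v ∈ Z
    · rw [h.branchRoots_empty i v hvZ hv, Finset.prod_empty]
    · rw [hbe v (hv' ⟨hv, hvZ⟩), Finset.prod_empty]
  have hN : (0 : ℝ) ≤ (motionPairs E θ w).card := Nat.cast_nonneg _
  have hnn : ∀ T' : RootedSimplexTree ι V, ∀ v, 0 ≤ ∑ y ∈ motionPairs E θ w,
      ∏ j ∈ T.branchRoots i v, T'.branchSum E j v y.1 y.2 := fun T' v =>
    Finset.sum_nonneg fun _ _ => Finset.prod_nonneg fun _ _ => T'.branchSum_nonneg E _ _ _ _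
  rw [h.vertexProd_eq E i he, h₁.vertexProd_eq E i he, h₂.vertexProd_eq E i he,
    pow_eq_rpow_mul_rpow hN hr ht (hcard i),
    Real.mul_rpow (by positivity) (Finset.prod_nonneg fun v _ => hnn T₁ v),
    Real.mul_rpow (by positivity) (Finset.prod_nonneg fun v _ => hnn T₂ v), hκ]
  have hmain := prod_le_of_le_rpow (r := r) (t := t) ((T.simplex i \ Z) \ e)
    (κ := fun v => ∏ j ∈ T.branchRoots i v, K j)
    (fun v _ => hnn T v) (fun v _ => hnn T₁ v) (fun v _ => hnn T₂ v) fun v hv => by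
      rw [Finset.mem_sdiff, Finset.mem_sdiff] at hv
      refine sum_le_of_le_rpow _ hr ht hrt (Finset.prod_nonneg fun j _ => (hK j).le)
        (fun y _ => Finset.prod_nonneg fun j _ => T₁.branchSum_nonneg E _ _ _ _)
        (fun y _ => Finset.prod_nonneg fun j _ => T₂.branchSum_nonneg E _ _ _ _) fun y _ => ?_
      exact prod_le_of_le_rpow _ (fun j _ => T.branchSum_nonneg E _ _ _ _)
        (fun j _ => T₁.branchSum_nonneg E _ _ _ _) (fun j _ => T₂.branchSum_nonneg E _ _ _ _)
        fun j hj => ih v hv.1.1 hv.1.2 j hj _ _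
  refine (mul_le_mul_of_nonneg_left hmain (by positivity)).trans (le_of_eq ?_)
  ring

/-- Induction from the leaves: Hölder for the sum over `θ`, then `vertexProd_le`, with the
stabilizer factors accumulating along the subtree. -/
theorem branchSum_le (h : T.SharesBranches T Z) (h₁ : T.SharesBranches T₁ Z)
    (h₂ : T.SharesBranches T₂ Z) (hr : 0 < r) (ht : 0 < t) (hrt : r + t = 1)
    (hcard : ∀ i, ((T.simplex i ∩ Z).card : ℝ) =
      r * (T₁.simplex i ∩ Z).card + t * (T₂.simplex i ∩ Z).card)
    (E : Finset (Fin d → F)) (i : ι) : ∀ v₀ ∉ Z, T.branchRoots i v₀ = ∅ → ∀ u u' : Fin d → F,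
      T.branchSum E i v₀ u u' ≤
        T.subtreeProd (fun i => stabFactor F d r t (T.dim i) (T₁.dim i) (T₂.dim i)) i *
          (T₁.branchSum E i v₀ u u' ^ r * T₂.branchSum E i v₀ u u' ^ t) := by
  refine T.descending_induction (P := fun i => ∀ v₀ ∉ Z, T.branchRoots i v₀ = ∅ →
    ∀ u u' : Fin d → F, T.branchSum E i v₀ u u' ≤
        T.subtreeProd (fun i => stabFactor F d r t (T.dim i) (T₁.dim i) (T₂.dim i)) i *
          (T₁.branchSum E i v₀ u u' ^ r * T₂.branchSum E i v₀ u u' ^ t)) (fun i ih => ?_) i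
  intro v₀ hv₀ hb u u'
  have hK := T.subtreeProd_pos (C := fun i => stabFactor F d r t (T.dim i) (T₁.dim i) (T₂.dim i))
    fun i => stabFactor_pos d r t _ _ _
  rw [branchSum_eq_vertexProd, branchSum_eq_vertexProd T₁, branchSum_eq_vertexProd T₂,
    subtreeProd_eq]
  refine inv_minStab_mul_le (Finset.sum_nonneg fun _ _ => T₁.vertexProd_nonneg E _ _ _ _)
    (Finset.sum_nonneg fun _ _ => T₂.vertexProd_nonneg E _ _ _ _) ?_
  refine sum_le_of_le_rpow _ hr ht hrt (Finset.prod_nonneg fun j _ => (hK j).le)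
    (fun _ _ => T₁.vertexProd_nonneg E _ _ _ _) (fun _ _ => T₂.vertexProd_nonneg E _ _ _ _)
    fun θ _ => ?_
  refine vertexProd_le h h₁ h₂ hr ht hrt hcard E i (by simpa using hv₀) (by simpa using hb) hK ?_ _ _
  intro v hv hvZ j hj x x'
  exact ih j (T.mem_branchRoots.1 hj).2 v hvZ (T.branchRoots_eq_empty_of_mem hv hj) x x'

theorem rootSum_le (h : T.SharesBranches T Z) (h₁ : T.SharesBranches T₁ Z)
    (h₂ : T.SharesBranches T₂ Z) (hr : 0 < r) (ht : 0 < t) (hrt : r + t = 1)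
    (hcard : ∀ i, ((T.simplex i ∩ Z).card : ℝ) =
      r * (T₁.simplex i ∩ Z).card + t * (T₂.simplex i ∩ Z).card)
    (E : Finset (Fin d → F)) :
    T.rootSum E ≤ (∏ i, stabFactor F d r t (T.dim i) (T₁.dim i) (T₂.dim i)) *
      (T₁.rootSum E ^ r * T₂.rootSum E ^ t) := by
  have hC : ∀ i, 0 < stabFactor F d r t (T.dim i) (T₁.dim i) (T₂.dim i) :=
    fun i => stabFactor_pos d r t _ _ _
  have hK := T.subtreeProd_pos hC
  rw [← T.subtreeProd_root hC, subtreeProd_eq, rootSum_eq_vertexProd, rootSum_eq_vertexProd T₁,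
    rootSum_eq_vertexProd T₂, h₁.root_eq, h₂.root_eq]
  have hκ : 0 ≤ ∏ j ∈ T.children T.root, T.subtreeProd
      (fun i => stabFactor F d r t (T.dim i) (T₁.dim i) (T₂.dim i)) j :=
    Finset.prod_nonneg fun j _ => (hK j).le
  refine inv_minStab_mul_le
    (Finset.sum_nonneg fun _ _ => Finset.sum_nonneg fun _ _ => T₁.vertexProd_nonneg E _ _ _ _)
    (Finset.sum_nonneg fun _ _ => Finset.sum_nonneg fun _ _ => T₂.vertexProd_nonneg E _ _ _ _) ?_
  refine sum_le_of_le_rpow _ hr ht hrt hκ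
    (fun _ _ => Finset.sum_nonneg fun _ _ => T₁.vertexProd_nonneg E _ _ _ _)
    (fun _ _ => Finset.sum_nonneg fun _ _ => T₂.vertexProd_nonneg E _ _ _ _) fun w _ => ?_
  refine sum_le_of_le_rpow _ hr ht hrt hκ
    (fun _ _ => T₁.vertexProd_nonneg E _ _ _ _) (fun _ _ => T₂.vertexProd_nonneg E _ _ _ _)
    fun θ _ => ?_
  refine vertexProd_le h h₁ h₂ hr ht hrt hcard E _ (Finset.disjoint_empty_left _) (by simp) hK ?_ _ _
  intro v hv hvZ j hj x x'
  exact branchSum_le h h₁ h₂ hr ht hrt hcard E j v hvZ (T.branchRoots_eq_empty_of_mem hv hj) x x'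

end ThreeTrees

end Interpolation

end RootedSimplexTree

/-! ### From the interpolation inequality to the threshold -/

namespace RootedSimplexTree

/-- The exponent of `Stab` is the class exponent plus an affine function of the dimension, and the
affine part cancels because `n = r a + t b` and `r + t = 1`. -/
theorem exists_stabFactor_le (d : ℕ) {r t : ℝ} (hr : 0 < r) (ht : 0 < t) (hrt : r + t = 1)
    {n a b : ℕ} (hn : (n : ℝ) = r * a + t * b) :
    ∃ D : ℝ, 0 < D ∧ ∀ (F : Type) [Field F] [Fintype F], ringChar F ≠ 2 →
      stabFactor F d r t n a b ≤ D * (Fintype.card F : ℝ) ^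
        (-(classExponent d n : ℝ) + (r * classExponent d a + t * classExponent d b)) := by
  obtain ⟨A, _, hA, _, hAn⟩ := exists_minStab_comparable d n
  obtain ⟨_, B, _, hB, hBa⟩ := exists_minStab_comparable d a
  obtain ⟨_, C, _, hC, hCb⟩ := exists_minStab_comparable d b
  refine ⟨A⁻¹ * (B ^ r * C ^ t), by positivity, fun F _ _ hF => ?_⟩
  have h1 := (hAn F hF).1
  have h2 := (hBa F hF).2
  have h3 := (hCb F hF).2
  set q : ℝ := (Fintype.card F : ℝ) with hq
  have hq0 : 0 < q := by rw [hq]; exact_mod_cast Fintype.card_pos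
  set P := ∑ j ∈ Finset.range d, (d - 1 - j) with hP
  calc stabFactor F d r t n a b
      ≤ (A * q ^ (classExponent d n - d * n + (P : ℤ)))⁻¹ *
        ((B * q ^ (classExponent d a - d * a + (P : ℤ))) ^ r *
          (C * q ^ (classExponent d b - d * b + (P : ℤ))) ^ t) := by
        unfold stabFactor
        gcongr
    _ = _ := by
        rw [← Real.rpow_intCast, ← Real.rpow_intCast, ← Real.rpow_intCast,
          Real.mul_rpow hB.le (Real.rpow_nonneg hq0.le _),
          Real.mul_rpow hC.le (Real.rpow_nonneg hq0.le _), ← Real.rpow_mul hq0.le,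
          ← Real.rpow_mul hq0.le, mul_inv, ← Real.rpow_neg hq0.le]
        have e : (-(classExponent d n : ℝ) + (r * classExponent d a + t * classExponent d b)) =
            -((classExponent d n - d * n + (P : ℤ) : ℤ) : ℝ) +
            (((classExponent d a - d * a + (P : ℤ) : ℤ) : ℝ) * r +
              ((classExponent d b - d * b + (P : ℤ) : ℤ) : ℝ) * t) := by
          push_cast
          linear_combination (-(d : ℝ)) * hn - (P : ℝ) * hrt
        rw [e, Real.rpow_add hq0, Real.rpow_add hq0]
        ring

theorem dim_eq {ι V : Type*} [DecidableEq V] (T : RootedSimplexTree ι V) (i : ι) (Z : Finset V) :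
    (T.dim i : ℝ) = (T.simplex i \ Z).card + (T.simplex i ∩ Z).card - 1 := by
  have h1 := (T.nonempty i).card_pos
  have h2 := Finset.card_sdiff_add_card_inter (T.simplex i) Z
  rw [dim, Nat.cast_sub h1, ← h2]
  push_cast
  rfl

section BoundHolds

variable {ι V : Type*} [Fintype ι] [DecidableEq V] {d : ℕ}

theorem BoundHolds.mono {T : RootedSimplexTree ι V} {s s' : ℝ} (h : T.BoundHolds d s)
    (hs : s ≤ s') : T.BoundHolds d s' := by
  intro A hA
  obtain ⟨B, hB⟩ := h A hA
  refine ⟨B, fun F _ _ hF E hE => hB F hF E (le_trans ?_ hE)⟩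
  have : (1 : ℝ) ≤ Fintype.card F := by exact_mod_cast Fintype.card_pos
  gcongr

theorem SharesBranches.boundHolds {T T₁ T₂ : RootedSimplexTree ι V} {Z : Finset V} {r t s : ℝ}
    (h : T.SharesBranches T Z) (h₁ : T.SharesBranches T₁ Z)
    (h₂ : T.SharesBranches T₂ Z) (hr : 0 < r) (ht : 0 < t) (hrt : r + t = 1)
    (hcard : ∀ i, ((T.simplex i ∩ Z).card : ℝ) =
      r * (T₁.simplex i ∩ Z).card + t * (T₂.simplex i ∩ Z).card)
    (hv₁ : T₁.vertices.card = T.vertices.card) (hv₂ : T₂.vertices.card = T.vertices.card)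
    (hB₁ : T₁.BoundHolds d s) (hB₂ : T₂.BoundHolds d s) : T.BoundHolds d s := by
  have hdim : ∀ i, (T.dim i : ℝ) = r * T₁.dim i + t * T₂.dim i := by
    intro i
    rw [T.dim_eq i Z, T₁.dim_eq i Z, T₂.dim_eq i Z, h₁.sdiff_eq, h₂.sdiff_eq, hcard]
    linear_combination (1 - ((T.simplex i \ Z).card : ℝ)) * hrt
  choose D hD hDF using fun i => exists_stabFactor_le d hr ht hrt (hdim i)
  intro A hA
  obtain ⟨B₁, hB₁⟩ := hB₁ A hA
  obtain ⟨B₂, hB₂⟩ := hB₂ A hA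
  -- Absolute values are taken because the given constants may be negative, while real powers need
  -- nonnegative bases.
  refine ⟨(∏ i, D i) * (|B₁| ^ r * |B₂| ^ t), fun F _ _ hF E hE => ?_⟩
  have e1 := hB₁ F hF E hE
  have e2 := hB₂ F hF E hE
  have e3 := rootSum_le h h₁ h₂ hr ht hrt hcard E
  have e4 : ∏ i, stabFactor F d r t (T.dim i) (T₁.dim i) (T₂.dim i) ≤
      ∏ i, (D i * (Fintype.card F : ℝ) ^ (-(classExponent d (T.dim i) : ℝ) +
        (r * classExponent d (T₁.dim i) + t * classExponent d (T₂.dim i)))) :=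
    Finset.prod_le_prod (fun i _ => (stabFactor_pos d r t _ _ _).le) fun i _ => hDF i F hF
  set q : ℝ := (Fintype.card F : ℝ) with hq
  have hq0 : 0 < q := by rw [hq]; exact_mod_cast Fintype.card_pos
  rw [Finset.prod_mul_distrib, ← Real.rpow_sum_of_pos hq0, Finset.sum_add_distrib,
    Finset.sum_add_distrib, ← Finset.mul_sum, ← Finset.mul_sum, Finset.sum_neg_distrib] at e4
  have hc : ∀ T' : RootedSimplexTree ι V,
      ∑ i, (classExponent d (T'.dim i) : ℝ) = (T'.treeExponent d : ℝ) := fun T' => by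
    rw [treeExponent]; push_cast; rfl
  rw [hc, hc, hc] at e4
  rw [hv₁] at e1
  rw [hv₂] at e2
  have n1 := T₁.rootSum_nonneg E
  have n2 := T₂.rootSum_nonneg E
  generalize T.treeExponent d = c at e4 ⊢
  generalize T₁.treeExponent d = c₁ at e1 e4
  generalize T₂.treeExponent d = c₂ at e2 e4
  set M : ℝ := (E.card : ℝ) ^ (2 * T.vertices.card) with hM
  have hM0 : 0 ≤ M := by positivity
  have hMM : M = M ^ r * M ^ t := by
    have := pow_eq_rpow_mul_rpow (x := M) hM0 hr ht (n := 1) (a := 1) (b := 1)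
      (by push_cast; linarith)
    simpa using this
  have m1 : 0 ≤ M * q ^ (-c₁) := mul_nonneg hM0 (zpow_pos hq0 _).le
  have m2 : 0 ≤ M * q ^ (-c₂) := mul_nonneg hM0 (zpow_pos hq0 _).le
  have f1 : T₁.rootSum E ≤ |B₁| * (M * q ^ (-c₁)) :=
    e1.trans (mul_le_mul_of_nonneg_right (le_abs_self _) m1)
  have f2 : T₂.rootSum E ≤ |B₂| * (M * q ^ (-c₂)) :=
    e2.trans (mul_le_mul_of_nonneg_right (le_abs_self _) m2)
  have hD0 : 0 < ∏ i, D i := Finset.prod_pos fun i _ => hD i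
  calc T.rootSum E ≤ _ := e3
    _ ≤ ((∏ i, D i) * q ^ (-(c : ℝ) +
          (r * c₁ + t * c₂))) *
        ((|B₁| * (M * q ^ (-c₁))) ^ r *
          (|B₂| * (M * q ^ (-c₂))) ^ t) :=
        mul_le_mul e4 (mul_le_mul (Real.rpow_le_rpow n1 f1 hr.le) (Real.rpow_le_rpow n2 f2 ht.le)
          (Real.rpow_nonneg n2 _) (Real.rpow_nonneg (n1.trans f1) _))
          (mul_nonneg (Real.rpow_nonneg n1 _) (Real.rpow_nonneg n2 _))
          (mul_nonneg hD0.le (Real.rpow_nonneg hq0.le _))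
    _ = _ := by
        rw [Real.mul_rpow (abs_nonneg _) m1, Real.mul_rpow (abs_nonneg _) m2,
          Real.mul_rpow hM0 (zpow_pos hq0 _).le, Real.mul_rpow hM0 (zpow_pos hq0 _).le,
          ← Real.rpow_intCast, ← Real.rpow_intCast, ← Real.rpow_intCast,
          ← Real.rpow_mul hq0.le, ← Real.rpow_mul hq0.le]
        have e : q ^ ((-c : ℤ) : ℝ) = q ^ (-(c : ℝ) +
            (r * c₁ + t * c₂)) *
            (q ^ (((-c₁ : ℤ) : ℝ) * r) *
              q ^ (((-c₂ : ℤ) : ℝ) * t)) := by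
          rw [← Real.rpow_add hq0, ← Real.rpow_add hq0]
          congr 1
          push_cast
          ring
        rw [e]
        conv_rhs => rw [hMM]
        ring

/-- By monotonicity in `s`, admissible exponents of the two trees may be replaced by their maximum.
-/
theorem threshold_le_max {T T₁ T₂ : RootedSimplexTree ι V}
    (h : ∀ s : ℝ, T₁.BoundHolds d s → T₂.BoundHolds d s → T.BoundHolds d s) :
    T.threshold d ≤ max (T₁.threshold d) (T₂.threshold d) := by
  by_contra! hlt
  rw [max_lt_iff] at hlt
  obtain ⟨⟨s₁, hs₁⟩, h₁⟩ := iInf_lt_iff.1 hlt.1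
  obtain ⟨⟨s₂, hs₂⟩, h₂⟩ := iInf_lt_iff.1 hlt.2
  have hB := h (max s₁ s₂) (hs₁.mono (le_max_left _ _)) (hs₂.mono (le_max_right _ _))
  have hle : T.threshold d ≤ ((max s₁ s₂ : ℝ) : EReal) :=
    iInf_le (fun s : {s : ℝ // T.BoundHolds d s} => ((s : ℝ) : EReal)) ⟨_, hB⟩
  rcases max_choice s₁ s₂ with e | e
  · rw [e] at hle; exact absurd h₁ (not_lt.2 hle)
  · rw [e] at hle; exact absurd h₂ (not_lt.2 hle)

end BoundHolds

/-! ### Moving free vertices leaves the branch structure intact -/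

section MoveFree

variable {ι V : Type*} [Fintype ι] [DecidableEq ι] [DecidableEq V]

theorem eq_of_mem_freeVertices (T : RootedSimplexTree ι V) {a i : ι} {v : V}
    (hv : v ∈ T.freeVertices a) (hi : v ∈ T.simplex i) : i = a := by
  by_contra h
  exact (Finset.mem_filter.1 hv).2 i h hi

theorem sharesBranches_self (T : RootedSimplexTree ι V) {Z : Finset V}
    (hZ : ∀ v ∈ Z, ∃ a, v ∈ T.freeVertices a) : T.SharesBranches T Z where
  root_eq := rfl
  branchRoots_eq _ _ _ := rfl
  branchRoots_empty i v hv hi := by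
    rw [Finset.eq_empty_iff_forall_notMem]
    intro j hj
    rw [mem_branchRoots] at hj
    obtain ⟨a, ha⟩ := hZ v hv
    rw [T.eq_of_mem_freeVertices ha hi, T.eq_of_mem_freeVertices ha hj.1] at hj
    exact lt_irrefl _ hj.2
  sdiff_eq _ := rfl

variable (T : RootedSimplexTree ι V) {a b : ι} (hab : a ≠ b) {X : Finset V}
  (hX : X ⊆ T.freeVertices b)

theorem moveFree_simplex (i : ι) : (T.moveFree a b hab X hX).simplex i =
    if i = a then T.simplex a ∪ X else if i = b then T.simplex b \ X else T.simplex i := rfl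

theorem moveFree_inter {i j : ι} (hij : i ≠ j) :
    (T.moveFree a b hab X hX).simplex i ∩ (T.moveFree a b hab X hX).simplex j =
      T.simplex i ∩ T.simplex j :=
  inter_move T.simplex hab (fun v hv => by simpa [freeVertices] using hX hv) i j hij

/-- Intersections of distinct simplices do not change, hence neither does the adjacency graph. -/
theorem moveFree_depth (i : ι) : (T.moveFree a b hab X hX).depth i = T.depth i := by
  have : (T.moveFree a b hab X hX).adjGraph = T.adjGraph := by
    ext i j
    constructor
    · rintro ⟨h, h'⟩
      exact ⟨h, by rwa [T.moveFree_inter hab hX h] at h'⟩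
    · rintro ⟨h, h'⟩
      exact ⟨h, by rwa [T.moveFree_inter hab hX h]⟩
  unfold depth
  rw [this]
  rfl

theorem mem_moveFree_simplex {v : V} (hv : v ∉ X) (i : ι) :
    v ∈ (T.moveFree a b hab X hX).simplex i ↔ v ∈ T.simplex i := by
  rw [moveFree_simplex]
  split_ifs with h1 h2
  · simp [h1, hv]
  · simp [h2, hv]
  · rfl

theorem sharesBranches_moveFree {Z : Finset V} (hXZ : X ⊆ Z)
    (hZ : ∀ v ∈ Z, ∃ c, v ∈ T.freeVertices c) :
    T.SharesBranches (T.moveFree a b hab X hX) Z where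
  root_eq := rfl
  branchRoots_eq i v hv := by
    ext j
    rw [mem_branchRoots, mem_branchRoots, moveFree_depth, moveFree_depth,
      mem_moveFree_simplex T hab hX fun h => hv (hXZ h)]
  branchRoots_empty i v hv hi := by
    rw [Finset.eq_empty_iff_forall_notMem]
    intro j hj
    rw [mem_branchRoots] at hj
    obtain ⟨c, hc⟩ := hZ v hv
    by_cases hij : i = j
    · subst hij
      exact lt_irrefl _ hj.2
    · have hm : v ∈ T.simplex i ∩ T.simplex j := by
        rw [← T.moveFree_inter hab hX hij]
        exact Finset.mem_inter.2 ⟨hi, hj.1⟩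
      rw [Finset.mem_inter] at hm
      exact hij ((T.eq_of_mem_freeVertices hc hm.1).trans
        (T.eq_of_mem_freeVertices hc hm.2).symm)
  sdiff_eq i := by
    ext v
    simp only [Finset.mem_sdiff]
    constructor
    · rintro ⟨h1, h2⟩
      exact ⟨(T.mem_moveFree_simplex hab hX (fun h => h2 (hXZ h)) i).1 h1, h2⟩
    · rintro ⟨h1, h2⟩
      exact ⟨(T.mem_moveFree_simplex hab hX (fun h => h2 (hXZ h)) i).2 h1, h2⟩

theorem moveFree_vertices : (T.moveFree a b hab X hX).vertices = T.vertices := by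
  ext v
  simp only [vertices, Finset.mem_biUnion, Finset.mem_univ, true_and]
  by_cases hv : v ∈ X
  · refine ⟨fun _ => ⟨b, (Finset.mem_filter.1 (hX hv)).1⟩, fun _ => ⟨a, ?_⟩⟩
    rw [moveFree_simplex, if_pos rfl]
    exact Finset.mem_union_right _ hv
  · simp only [mem_moveFree_simplex T hab hX hv]

theorem card_moveFree_inter {Z : Finset V} (hXZ : X ⊆ Z) (i : ι) :
    (((T.moveFree a b hab X hX).simplex i ∩ Z).card : ℝ) = (T.simplex i ∩ Z).card +
      if i = a then (X.card : ℝ) else if i = b then -(X.card : ℝ) else 0 := by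
  rw [moveFree_simplex]
  split_ifs with h1 h2
  · subst h1
    have hd : Disjoint (T.simplex i ∩ Z) X := by
      rw [Finset.disjoint_left]
      intro v hv hvX
      exact hab (T.eq_of_mem_freeVertices (hX hvX) (Finset.mem_inter.1 hv).1)
    rw [Finset.union_inter_distrib_right, Finset.inter_eq_left.2 hXZ,
      Finset.card_union_of_disjoint hd]
    push_cast
    rfl
  · subst h2
    have hs : X ⊆ T.simplex i ∩ Z := fun v hv =>
      Finset.mem_inter.2 ⟨(Finset.mem_filter.1 (hX hv)).1, hXZ hv⟩
    have : (T.simplex i \ X) ∩ Z = (T.simplex i ∩ Z) \ X := by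
      ext v; simp only [Finset.mem_inter, Finset.mem_sdiff]; tauto
    rw [this, Finset.card_sdiff_of_subset hs, Nat.cast_sub (Finset.card_le_card hs)]
    ring
  · simp

end MoveFree

end RootedSimplexTree

theorem lemma4p6 {ι V : Type*} [Fintype ι] [DecidableEq ι] [DecidableEq V] (d : ℕ)
    (T : RootedSimplexTree ι V) (i₁ i₂ : ι) (hne : i₁ ≠ i₂)
    (hdim₁ : 2 ≤ T.dim i₁) (hdim₂ : 2 ≤ T.dim i₂)
    (k₁ k₂ : ℕ) (hk₁ : 0 < k₁) (hk₂ : 0 < k₂)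
    (X₁ X₂ : Finset V) (hX₁ : X₁ ⊆ T.freeVertices i₁) (hX₂ : X₂ ⊆ T.freeVertices i₂)
    (hcard₁ : X₁.card = k₁) (hcard₂ : X₂.card = k₂) :
    T.threshold d ≤
      max ((T.moveFree i₁ i₂ hne X₂ hX₂).threshold d)
        ((T.moveFree i₂ i₁ hne.symm X₁ hX₁).threshold d) := by
  have hk₁' : (0 : ℝ) < k₁ := by exact_mod_cast hk₁
  have hk₂' : (0 : ℝ) < k₂ := by exact_mod_cast hk₂
  have hZ : ∀ v ∈ X₁ ∪ X₂, ∃ c, v ∈ T.freeVertices c := fun v hv => by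
    rcases Finset.mem_union.1 hv with h | h
    · exact ⟨i₁, hX₁ h⟩
    · exact ⟨i₂, hX₂ h⟩
  refine RootedSimplexTree.threshold_le_max fun s h₁ h₂ => ?_
  refine (T.sharesBranches_self hZ).boundHolds
    (T.sharesBranches_moveFree hne hX₂ Finset.subset_union_right hZ)
    (T.sharesBranches_moveFree hne.symm hX₁ Finset.subset_union_left hZ)
    -- The weights are chosen so that `r k₂ = t k₁`: the gain of each of the two simplices in one
    -- tree balances its loss in the other.
    (r := k₁ / (k₁ + k₂)) (t := k₂ / (k₁ + k₂)) (by positivity) (by positivity)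
    (by rw [← add_div]; exact div_self (by positivity)) (fun i => ?_)
    (by rw [T.moveFree_vertices]) (by rw [T.moveFree_vertices]) h₁ h₂
  rw [T.card_moveFree_inter hne hX₂ Finset.subset_union_right,
    T.card_moveFree_inter hne.symm hX₁ Finset.subset_union_left, hcard₁, hcard₂]
  by_cases e₁ : i = i₁
  · subst e₁
    simp only [if_true, if_neg hne]
    field_simp
    ring
  · by_cases e₂ : i = i₂
    · subst e₂
      simp only [if_true, if_neg e₁]
      field_simp
      ring
    · simp only [if_neg e₁, if_neg e₂]
      field_simp
      ring
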